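/- Let $(R,\mathfrak m,k)$ be a commutative local ring (noetherian or not). An $R$-module $C$ is *semidualizing* if it has a (possibly unbounded) resolution by finite rank free modules, the homothety map $R\to\operatorname{Hom}_R(C,C)$ is bijective, and $\operatorname{Ext}_R^{i}(C,C)=0$ for all $i\ge 1$. Let $C$ be a semidualizing $R$-module with $C\not\cong R$. Write $\mathcal P_C$ for the class of modules isomorphic to $P\otimes_R C$ with $P$ projective. Write $\mathcal{GP}_C$ for the class of modules isomorphic to $\operatorname{Coker}(\partial^X_1)$ for some exact complex $X$ that is $\operatorname{Hom}_R(-,\mathcal P_C)$-exact, with $X_i$ projective for $i\ge 0$ and $X_i\in\mathcal P_C$ for $i<0$. For a class $\mathcal X$ of modules, an *$\mathcal X$-resolution* of $M$ is a complex $X=(\cdots\to X_1\to X_0\to 0)$ of modules in $\mathcal X$ with an augmentation $X_0\to M$ such that $X^+=(\cdots\to X_1\to X_0\to M\to 0)$ is exact; it is *proper* if $\operatorname{Hom}_R(G,X^+)$ is exact for all $G\in\mathcal X$. Set $\mathcal X\text{-pd}(M)=\inf_X\sup\{n\ge 0: X_n\ne 0\}$, the infimum being over all $\mathcal X$-resolutions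 $X$ of $M$. If $X$ is a proper $\mathcal X$-resolution of $M$, set $\operatorname{Ext}^n_{\mathcal X}(M,N)=H^n(\operatorname{Hom}_R(X,N))$, and let $\varkappa^n_{\mathcal X}(M,N)\colon\operatorname{Ext}^n_{\mathcal X}(M,N)\to\operatorname{Ext}^n_R(M,N)$ be the map induced by a lift $P\to X$ of $\mathrm{id}_M$, where $P$ is a projective resolution of $M$. (a) The module $C$ admits proper $\mathcal P_C$- and $\mathcal{GP}_C$-resolutions, and for every $n\ge 1$ one has $\operatorname{Ext}^n_{\mathcal P_C}(C,k)=0=\operatorname{Ext}^n_{\mathcal{GP}_C}(C,k)$ and $\operatorname{Ext}^n_R(C,k)\ne 0$. (b) Let $x\in\mathfrak m$ be a non-zero-divisor on $R$. Then the exact sequence $0\to R\xrightarrow{x}R\to R/xR\to 0$ is not $\operatorname{Hom}_R(\mathcal{GP}_C,-)$-exact. The module $R/xR$ admits a proper $\mathcal{GP}_C$-resolution, and the natural map $\varkappa^1_{\mathcal{GP}_C}(R/xR,R)\colon\operatorname{Ext}^1_{\mathcal{GP}_C}(R/xR,R)\to\operatorname{Ext}^1_R(R/xR,R)$ is injective but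 not surjective. If $\dim R=1$, then $\operatorname{Ext}^1_{\mathcal{GP}_C}(R/xR,R)\not\cong\operatorname{Ext}^1_R(R/xR,R)$ as $R$-modules. (c) Let $M$ be an $R$-module that admits a proper $\mathcal P_C$-resolution, with $\mathcal{GP}_C\text{-pd}(M)<\infty=\mathcal P_C\text{-pd}(M)$. Then $M$ admits a proper $\mathcal{GP}_C$-resolution, and for every $n>\mathcal{GP}_C\text{-pd}(M)$ one has $\operatorname{Ext}^n_{\mathcal{GP}_C}(M,N)=0$ for all $R$-modules $N$, while $\operatorname{Ext}^n_{\mathcal P_C}(M,N)\ne 0$ for some $R$-module $N$. -/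

import Mathlib

open CategoryTheory

universe u

namespace RelCoh

noncomputable section

variable {R : Type u} [CommRing R]

/-- The complex `Hom_R(G, K)`, for a module `G` and a complex `K` of modules. -/
abbrev homFrom {ι : Type} {c : ComplexShape ι} (G : ModuleCat.{u} R)
    (K : HomologicalComplex (ModuleCat.{u} R) c) : HomologicalComplex (ModuleCat.{u} R) c :=
  (((linearCoyoneda R (ModuleCat.{u} R)).obj (Opposite.op G)).mapHomologicalComplex c).obj K

/-- The chain map `Hom_R(f, N) : Hom_R(Y, N) ⟶ Hom_R(X, N)` (precomposition with `f`)
induced by a chain map `f : X ⟶ Y`. -/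
def homMap {X Y : ChainComplex (ModuleCat.{u} R) ℕ} (f : X ⟶ Y) (N : ModuleCat.{u} R) :
    Y.linearYonedaObj R N ⟶ X.linearYonedaObj R N where
  f i := ((linearYoneda R (ModuleCat.{u} R)).obj N).map (f.f i).op
  comm' i j _ := by
    change _ ≫ ((linearYoneda R (ModuleCat.{u} R)).obj N).map (X.d j i).op =
      ((linearYoneda R (ModuleCat.{u} R)).obj N).map (Y.d j i).op ≫ _
    rw [← Functor.map_comp, ← Functor.map_comp, ← op_comp, ← op_comp, f.comm]

/-- An `𝒳`-resolution of `M`: a complex `⋯ → X₁ → X₀ → 0` of modules in `𝒳` and an augmentation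
`X₀ → M` such that the augmented complex `⋯ → X₁ → X₀ → M → 0` is exact. -/
structure Resolution (𝒳 : ObjectProperty (ModuleCat.{u} R)) (M : ModuleCat.{u} R) where
  complex : ChainComplex (ModuleCat.{u} R) ℕ
  mem : ∀ n, 𝒳 (complex.X n)
  π : complex.X 0 ⟶ M
  d_comp_π : complex.d 1 0 ≫ π = 0
  acyclic : (complex.augment π d_comp_π).Acyclic

namespace Resolution

variable {𝒳 : ObjectProperty (ModuleCat.{u} R)} {M : ModuleCat.{u} R} (X : Resolution 𝒳 M)

/-- The augmented resolution `⋯ → X₁ → X₀ → M → 0` (with `M` in degree `0`). -/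
def augmented : ChainComplex (ModuleCat.{u} R) ℕ := X.complex.augment X.π X.d_comp_π

/-- The resolution is proper if its augmented complex is `Hom_R(𝒳, -)`-exact. -/
def IsProper : Prop := ∀ G : ModuleCat.{u} R, 𝒳 G → (homFrom G X.augmented).Acyclic

/-- The `n`-th cohomology module of `Hom_R(X, N)`. For a proper `𝒳`-resolution `X` of `M` this is
the relative cohomology module `Ext_𝒳^n(M, N)`. -/
def ext (N : ModuleCat.{u} R) (n : ℕ) : ModuleCat.{u} R :=
  (X.complex.linearYonedaObj R N).homology n

/-- The chain maps `P ⟶ X` lifting the identity of `M`, from a projective resolution `P` of `M`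
to an `𝒳`-resolution `X` of `M`. -/
structure Lift (P : ProjectiveResolution M) where
  hom : P.complex ⟶ X.complex
  comm : hom.f 0 ≫ X.π = P.π.f 0

/-- The comparison map `Ext_𝒳^n(M, N) ⟶ Ext_R^n(M, N)`: the map induced on cohomology
by `Hom_R(φ, N)`, for a lift `φ : P ⟶ X` of the identity of `M`, followed by the canonical
identification of `H^n(Hom_R(P, N))` with `Ext_R^n(M, N)`. -/
def comparison {P : ProjectiveResolution M} (φ : X.Lift P) (N : ModuleCat.{u} R) (n : ℕ) :
    X.ext N n ⟶ ((Ext R (ModuleCat.{u} R) n).obj (Opposite.op M)).obj N :=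
  HomologicalComplex.homologyMap (homMap φ.hom N) n ≫ (P.isoExt n N).inv

/-- `sup {n ≥ 0 | Xₙ ≠ 0}`. -/
def length : WithBot ℕ∞ :=
  ⨆ (n : ℕ) (_ : Nontrivial (X.complex.X n)), ((n : ℕ∞) : WithBot ℕ∞)

end Resolution

/-- `M` admits a proper `𝒳`-resolution. -/
def HasProperResolution (𝒳 : ObjectProperty (ModuleCat.{u} R)) (M : ModuleCat.{u} R) : Prop :=
  ∃ X : Resolution 𝒳 M, X.IsProper

/-- The `𝒳`-projective dimension of `M`: the infimum of the lengths of the `𝒳`-resolutions of `M`.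
It is `⊤` (infinite) if there is no bounded one, and `⊥` if `M = 0` and `𝒳` contains `0`. -/
def relPd (𝒳 : ObjectProperty (ModuleCat.{u} R)) (M : ModuleCat.{u} R) : WithBot ℕ∞ :=
  ⨅ X : Resolution 𝒳 M, X.length

/-- A short sequence `0 → A → B → D → 0` is `Hom_R(𝒳, -)`-exact if
`0 → Hom_R(G, A) → Hom_R(G, B) → Hom_R(G, D) → 0` is exact for each `G` in `𝒳`. -/
def IsHomExact (𝒳 : ObjectProperty (ModuleCat.{u} R)) (S : ShortComplex (ModuleCat.{u} R)) :
    Prop :=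
  ∀ G : ModuleCat.{u} R, 𝒳 G →
    (S.map ((linearCoyoneda R (ModuleCat.{u} R)).obj (Opposite.op G))).ShortExact

/-- The class of free modules of finite rank. -/
def finiteFree (R : Type u) [CommRing R] : ObjectProperty (ModuleCat.{u} R) :=
  fun F => Module.Free R F ∧ Module.Finite R F

/-- Semidualizing modules. -/
structure IsSemidualizing (C : ModuleCat.{u} R) : Prop where
  resolution : Nonempty (Resolution (finiteFree R) C)
  homothety : Function.Bijective (LinearMap.lsmul R C : R → C →ₗ[R] C)
  ext_self : ∀ n : ℕ, 1 ≤ n →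
    Subsingleton (((Ext R (ModuleCat.{u} R) n).obj (Opposite.op C)).obj C)

/-- The class of `C`-projective modules: those isomorphic to `P ⊗_R C` with `P` projective. -/
def PC (C : ModuleCat.{u} R) : ObjectProperty (ModuleCat.{u} R) :=
  fun M => ∃ P : ModuleCat.{u} R, Module.Projective R P ∧ Nonempty (M ≃ₗ[R] TensorProduct R P C)

/-- A complete `𝒫𝒫_C`-resolution: an exact and `Hom_R(-, 𝒫_C)`-exact complex `X`
with `Xᵢ` projective for `i ≥ 0` and `C`-projective for `i < 0`. -/
structure IsCompleteResolution (C : ModuleCat.{u} R) (X : ChainComplex (ModuleCat.{u} R) ℤ) :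
    Prop where
  acyclic : X.Acyclic
  hom_acyclic : ∀ Y : ModuleCat.{u} R, PC C Y → (X.linearYonedaObj R Y).Acyclic
  projective : ∀ i : ℤ, 0 ≤ i → Module.Projective R (X.X i)
  cProjective : ∀ i : ℤ, i < 0 → PC C (X.X i)

/-- The class of `G_C`-projective modules: the cokernels of `∂₁ : X₁ → X₀`, for `X` a complete
`𝒫𝒫_C`-resolution. -/
def GPC (C : ModuleCat.{u} R) : ObjectProperty (ModuleCat.{u} R) :=
  fun G => ∃ X : ChainComplex (ModuleCat.{u} R) ℤ, IsCompleteResolution C X ∧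
    Nonempty (G ≃ₗ[R] X.X 0 ⧸ LinearMap.range (X.d 1 0).hom)

/-- The sequence `0 → R → R → R/xR → 0`, where the first map is multiplication by `x`
and the second one is the canonical surjection. -/
def mulSequence (x : R) : ShortComplex (ModuleCat.{u} R) :=
  ShortComplex.mk (X₁ := ModuleCat.of R R) (X₂ := ModuleCat.of R R)
    (X₃ := ModuleCat.of R (R ⧸ Ideal.span {x}))
    (ModuleCat.ofHom (LinearMap.lsmul R R x)) (ModuleCat.ofHom (Ideal.span {x}).mkQ)
    (by
      ext
      simp)

end

end RelCoh

/-! Two facts about a semidualizing module `C` with `C ≇ R` drive everything. Every map from a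
`C`-projective module to `R` has its image in the maximal ideal (`PC.apply_mem_maximalIdeal`), and
both `C` and `R` are `G_C`-projective (`IsSemidualizing.PC_le_GPC`, `IsSemidualizing.gpc_ring`).

(a) Since `C` lies in both classes, it is its own proper resolution, so relative `Ext` vanishes in
positive degrees. If some `Ext^n(C, k)` with `n ≥ 1` vanished, a syzygy in a finite free resolution
of `C` would be free. Because `Ext(C, C) = 0`, freeness descends through the syzygies to `C`. Then a
coordinate functional of `C` takes the value `1`, which the first fact forbids.

(b) Push `0 → R → R → R/xR → 0` out along an embedding `R → U` with `U` `C`-projective and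
`G_C`-projective cokernel. This yields `0 → U → G → R/xR → 0` with `G` `G_C`-projective. A lift `G →
R` of `G → R/xR` restricts to `x` times a map `U → R` with a unit value, which is impossible
(`IsSemidualizing.not_forall_exists_lift`). The comparison map is injective by a gluing argument on
the cone of `P → X`. Were it surjective, the class of the sequence above would come from a relative
class, and gluing would produce the forbidden lifts. If `dim R = 1`, then `Ext^1(R/xR, R)` is cyclic
and killed by `x`, so its injective endomorphisms are surjective and no abstract isomorphism can
exist.

(c) A module of finite `GPC`-dimension embeds in one of finite `PC`-dimension with `G_C`-projective
cokernel (`IsSemidualizing.exists_hull`). Applied to a first syzygy and combined with a pushout,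
this gives a resolution with only its degree `0` term outside `PC`. It is proper because `Ext` from
`GPC` to modules of finite `PC`-dimension vanishes. If `Ext_PC^n(M, -)` vanished, a syzygy would
split off, and since `PC` is closed under retracts, `M` would have finite `PC`-dimension. -/

namespace RelCoh
noncomputable section
variable {R : Type u} [CommRing R]

/-! ### Exactness of complexes in terms of elements and maps. -/

theorem acyclic_nat_iff (K : ChainComplex (ModuleCat.{u} R) ℕ) :
    K.Acyclic ↔ Function.Surjective (K.d 1 0) ∧
      ∀ n, ∀ x : K.X (n + 1), K.d (n + 1) n x = 0 → ∃ y, K.d (n + 2) (n + 1) y = x := by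
  have h0 : K.ExactAt 0 ↔ Function.Surjective (K.d 1 0) := by
    rw [K.exactAt_iff' 1 0 0 (by simp) (by simp), ShortComplex.moduleCat_exact_iff]
    have hz : K.d 0 0 = 0 := K.shape _ _ (by simp)
    exact ⟨fun h x => h x (congr($hz x)), fun h x _ => h x⟩
  have h1 (n : ℕ) : K.ExactAt (n + 1) ↔
      ∀ x : K.X (n + 1), K.d (n + 1) n x = 0 → ∃ y, K.d (n + 2) (n + 1) y = x := by
    rw [K.exactAt_iff' (n + 2) (n + 1) n (by simp) (by simp), ShortComplex.moduleCat_exact_iff]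
    rfl
  constructor
  · exact fun h => ⟨h0.1 (h 0), fun n => (h1 n).1 (h (n + 1))⟩
  · rintro ⟨h, h'⟩ (_ | n)
    · exact h0.2 h
    · exact (h1 n).2 (h' n)

theorem homFrom_acyclic_iff (G : ModuleCat.{u} R) (K : ChainComplex (ModuleCat.{u} R) ℕ) :
    (homFrom G K).Acyclic ↔ (∀ f : G ⟶ K.X 0, ∃ g : G ⟶ K.X 1, g ≫ K.d 1 0 = f) ∧
      ∀ n, ∀ f : G ⟶ K.X (n + 1), f ≫ K.d (n + 1) n = 0 →
        ∃ g : G ⟶ K.X (n + 2), g ≫ K.d (n + 2) (n + 1) = f := by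
  rw [acyclic_nat_iff]
  rfl

theorem linearYonedaObj_exactAt_succ_iff (K : ChainComplex (ModuleCat.{u} R) ℕ)
    (N : ModuleCat.{u} R) (n : ℕ) :
    (K.linearYonedaObj R N).ExactAt (n + 1) ↔ ∀ f : K.X (n + 1) ⟶ N, K.d (n + 2) (n + 1) ≫ f = 0 →
      ∃ g : K.X n ⟶ N, K.d (n + 1) n ≫ g = f := by
  rw [HomologicalComplex.exactAt_iff' _ n (n + 1) (n + 2) (by simp) (by simp),
    ShortComplex.moduleCat_exact_iff]
  rfl

theorem linearYonedaObj_homology_subsingleton_iff (K : ChainComplex (ModuleCat.{u} R) ℕ)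
    (N : ModuleCat.{u} R) (n : ℕ) :
    Subsingleton ((K.linearYonedaObj R N).homology (n + 1)) ↔
      ∀ f : K.X (n + 1) ⟶ N, K.d (n + 2) (n + 1) ≫ f = 0 →
        ∃ g : K.X n ⟶ N, K.d (n + 1) n ≫ g = f := by
  rw [← linearYonedaObj_exactAt_succ_iff, HomologicalComplex.exactAt_iff_isZero_homology,
    ModuleCat.isZero_iff_subsingleton]

theorem acyclic_int_iff (K : ChainComplex (ModuleCat.{u} R) ℤ) :
    K.Acyclic ↔ ∀ i, ∀ x : K.X (i + 1), K.d (i + 1) i x = 0 →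
      ∃ y, K.d (i + 1 + 1) (i + 1) y = x := by
  have h1 (i : ℤ) : K.ExactAt (i + 1) ↔
      ∀ x : K.X (i + 1), K.d (i + 1) i x = 0 → ∃ y, K.d (i + 1 + 1) (i + 1) y = x := by
    rw [K.exactAt_iff' (i + 1 + 1) (i + 1) i (by simp) (by simp), ShortComplex.moduleCat_exact_iff]
    rfl
  constructor
  · exact fun h i => (h1 i).1 (h _)
  · intro h i
    obtain ⟨i, rfl⟩ : ∃ j, i = j + 1 := ⟨i - 1, by simp⟩
    exact (h1 i).2 (h i)

theorem linearYonedaObj_acyclic_int_iff (K : ChainComplex (ModuleCat.{u} R) ℤ)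
    (N : ModuleCat.{u} R) :
    (K.linearYonedaObj R N).Acyclic ↔ ∀ i, ∀ f : K.X (i + 1) ⟶ N,
      K.d (i + 1 + 1) (i + 1) ≫ f = 0 → ∃ g : K.X i ⟶ N, K.d (i + 1) i ≫ g = f := by
  have h1 (i : ℤ) : (K.linearYonedaObj R N).ExactAt (i + 1) ↔ ∀ f : K.X (i + 1) ⟶ N,
      K.d (i + 1 + 1) (i + 1) ≫ f = 0 → ∃ g : K.X i ⟶ N, K.d (i + 1) i ≫ g = f := by
    rw [HomologicalComplex.exactAt_iff' _ i (i + 1) (i + 1 + 1) (by simp) (by simp),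
      ShortComplex.moduleCat_exact_iff]
    rfl
  constructor
  · exact fun h i => (h1 i).1 (h _)
  · intro h i
    obtain ⟨i, rfl⟩ : ∃ j, i = j + 1 := ⟨i - 1, by simp⟩
    exact (h1 i).2 (h i)

/-! ### Comparison of relative resolutions. -/

namespace Resolution
variable {𝒳 : ObjectProperty (ModuleCat.{u} R)} {M : ModuleCat.{u} R}

theorem acyclic_augment_iff (K : ChainComplex (ModuleCat.{u} R) ℕ) (π : K.X 0 ⟶ M)
    (w : K.d 1 0 ≫ π = 0) : (K.augment π w).Acyclic ↔ Function.Surjective π ∧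
      (∀ x, π x = 0 → ∃ y, K.d 1 0 y = x) ∧
      ∀ n, ∀ x : K.X (n + 1), K.d (n + 1) n x = 0 → ∃ y, K.d (n + 2) (n + 1) y = x := by
  rw [acyclic_nat_iff]
  refine and_congr Iff.rfl ⟨fun h => ⟨h 0, fun n => h (n + 1)⟩, ?_⟩
  rintro ⟨h, h'⟩ (_ | n)
  exacts [h, h' n]

theorem homFrom_augment_acyclic_iff (G : ModuleCat.{u} R) (K : ChainComplex (ModuleCat.{u} R) ℕ)
    (π : K.X 0 ⟶ M) (w : K.d 1 0 ≫ π = 0) : (homFrom G (K.augment π w)).Acyclic ↔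
      (∀ f : G ⟶ M, ∃ g, g ≫ π = f) ∧
      (∀ f : G ⟶ K.X 0, f ≫ π = 0 → ∃ g : G ⟶ K.X 1, g ≫ K.d 1 0 = f) ∧
      ∀ n, ∀ f : G ⟶ K.X (n + 1), f ≫ K.d (n + 1) n = 0 →
        ∃ g : G ⟶ K.X (n + 2), g ≫ K.d (n + 2) (n + 1) = f := by
  rw [homFrom_acyclic_iff]
  refine and_congr Iff.rfl ⟨fun h => ⟨h 0, fun n => h (n + 1)⟩, ?_⟩
  rintro ⟨h, h'⟩ (_ | n)
  exacts [h, h' n]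

theorem homFrom_augmented_acyclic_of_projective (X : Resolution 𝒳 M) (P : ModuleCat.{u} R)
    [Projective P] : (homFrom P X.augmented).Acyclic := by
  intro i
  have h := X.acyclic i
  rw [HomologicalComplex.exactAt_iff, ShortComplex.moduleCat_exact_iff]
  intro (f : P ⟶ _) hf
  rw [HomologicalComplex.exactAt_iff] at h
  exact ⟨h.liftFromProjective f hf, h.liftFromProjective_comp f hf⟩

/-- The usual comparison theorem, with projectivity of the `K_n` replaced by exactness of `Hom(K_n,
L⁺)`. It serves both for projective and for proper relative resolutions. -/
theorem exists_chainMap {K L : ChainComplex (ModuleCat.{u} R) ℕ} (π : K.X 0 ⟶ M)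
    (w : K.d 1 0 ≫ π = 0) (ρ : L.X 0 ⟶ M) (v : L.d 1 0 ≫ ρ = 0)
    (h : ∀ n, (homFrom (K.X n) (L.augment ρ v)).Acyclic) :
    ∃ φ : K ⟶ L, φ.f 0 ≫ ρ = π := by
  simp only [homFrom_augment_acyclic_iff] at h
  obtain ⟨φ₀, h₀⟩ := (h 0).1 π
  obtain ⟨φ₁, h₁⟩ := (h 1).2.1 (K.d 1 0 ≫ φ₀) (by rw [Category.assoc, h₀, w])
  choose s hs using fun n => (h (n + 2)).2.2 n
  exact ⟨ChainComplex.mkHom K L φ₀ φ₁ h₁ fun n p => ⟨s n (K.d (n + 2) (n + 1) ≫ p.2.1)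
    (by rw [Category.assoc, p.2.2, K.d_comp_d_assoc, Limits.zero_comp]), hs n _ _⟩, h₀⟩

/-- Only two consecutive components of a null-homotopy are needed. The induction therefore keeps
just the homotopy relation precomposed with the differential of `K`, in which the preceding
component drops out. -/
theorem exists_homotopy_succ {K L : ChainComplex (ModuleCat.{u} R) ℕ}
    (ρ : L.X 0 ⟶ M) (v : L.d 1 0 ≫ ρ = 0)
    (h : ∀ n, (homFrom (K.X n) (L.augment ρ v)).Acyclic) (e : K ⟶ L) (he : e.f 0 ≫ ρ = 0)
    (n : ℕ) : ∃ (s : K.X n ⟶ L.X (n + 1)) (t : K.X (n + 1) ⟶ L.X (n + 2)),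
      e.f (n + 1) = K.d (n + 1) n ≫ s + t ≫ L.d (n + 2) (n + 1) := by
  simp only [homFrom_augment_acyclic_iff] at h
  have key (n : ℕ) (s : K.X n ⟶ L.X (n + 1))
      (hs : K.d (n + 1) n ≫ s ≫ L.d (n + 1) n = K.d (n + 1) n ≫ e.f n) :
      ∃ t : K.X (n + 1) ⟶ L.X (n + 2),
        e.f (n + 1) = K.d (n + 1) n ≫ s + t ≫ L.d (n + 2) (n + 1) := by
    obtain ⟨t, ht⟩ := (h (n + 1)).2.2 n (e.f (n + 1) - K.d (n + 1) n ≫ s)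
      (by rw [Preadditive.sub_comp, Category.assoc, hs, e.comm, sub_self])
    exact ⟨t, by rw [ht]; abel⟩
  have main (n : ℕ) : ∃ s : K.X n ⟶ L.X (n + 1),
      K.d (n + 1) n ≫ s ≫ L.d (n + 1) n = K.d (n + 1) n ≫ e.f n := by
    induction n with
    | zero =>
      obtain ⟨s, hs⟩ := (h 0).2.1 _ he
      exact ⟨s, by rw [hs]⟩
    | succ n ih =>
      obtain ⟨s, hs⟩ := ih
      obtain ⟨t, ht⟩ := key n s hs
      exact ⟨t, by rw [ht, Preadditive.comp_add, K.d_comp_d_assoc, Limits.zero_comp, zero_add]⟩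
  obtain ⟨s, hs⟩ := main n
  exact ⟨s, key n s hs⟩

/-- The identity of `X` is homotopic to a map factoring through `Y`, and that map is zero in degree
`n + 1`. Hence relative `Ext` can be tested on one conveniently short proper resolution. -/
theorem subsingleton_ext_succ_of_subsingleton (X Y : Resolution 𝒳 M) (hX : X.IsProper)
    (hY : Y.IsProper) (N : ModuleCat.{u} R) (n : ℕ) (hn : Subsingleton (Y.complex.X (n + 1))) :
    Subsingleton (X.ext N (n + 1)) := by
  obtain ⟨φ, hφ⟩ := exists_chainMap X.π X.d_comp_π Y.π Y.d_comp_π fun n => hY _ (X.mem n)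
  obtain ⟨ψ, hψ⟩ := exists_chainMap Y.π Y.d_comp_π X.π X.d_comp_π fun n => hX _ (Y.mem n)
  obtain ⟨s, t, h⟩ := exists_homotopy_succ X.π X.d_comp_π (fun n => hX _ (X.mem n))
    (𝟙 _ - φ ≫ ψ) (by simp [Preadditive.sub_comp, hφ, hψ]) n
  refine (linearYonedaObj_homology_subsingleton_iff _ _ _).2 fun f hf => ⟨s ≫ f, ?_⟩
  have hz : φ.f (n + 1) = 0 :=
    (ModuleCat.isZero_of_subsingleton (Y.complex.X (n + 1))).eq_of_tgt _ _
  have h' := congr($h ≫ f)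
  simpa [hz, Preadditive.add_comp, hf] using h'.symm

theorem nonempty_lift (X : Resolution 𝒳 M) (P : ProjectiveResolution M) : Nonempty (X.Lift P) := by
  obtain ⟨φ, hφ⟩ := exists_chainMap (K := P.complex) (P.π.f 0) P.complex_d_comp_π_f_zero
    X.π X.d_comp_π fun n => X.homFrom_augmented_acyclic_of_projective (P.complex.X n)
  exact ⟨⟨φ, hφ⟩⟩

/-- A resolution by projective modules is a projective resolution. -/
def toProjectiveResolution (X : Resolution 𝒳 M) (h : ∀ n, Projective (X.complex.X n)) :
    ProjectiveResolution M where
  complex := X.complex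
  projective := h
  π := (ChainComplex.toSingle₀Equiv X.complex M).symm ⟨X.π, X.d_comp_π⟩
  quasiIso := by
    refine ⟨fun n => ?_⟩
    obtain ⟨h₁, h₂, h₃⟩ := (acyclic_augment_iff _ _ _).1 X.acyclic
    cases n with
    | zero =>
      rw [ChainComplex.quasiIsoAt₀_iff, ShortComplex.quasiIso_iff_of_zeros' _
        (X.complex.shape _ _ (by simp)) rfl rfl]
      have hπ : ((ChainComplex.toSingle₀Equiv X.complex M).symm ⟨X.π, X.d_comp_π⟩).f 0 = X.π :=
        ChainComplex.toSingle₀Equiv_symm_apply_f_zero _ _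
      constructor
      · rw [ShortComplex.moduleCat_exact_iff]
        exact fun x hx => h₂ x (congr($hπ x).symm.trans hx)
      · refine (ModuleCat.epi_iff_surjective _).2 fun y => ?_
        obtain ⟨x, hx⟩ := h₁ y
        exact ⟨x, congr($hπ x).trans hx⟩
    | succ n =>
      rw [quasiIsoAt_iff_exactAt' _ _ (ChainComplex.exactAt_succ_single_obj _ _),
        HomologicalComplex.exactAt_iff' _ (n + 2) (n + 1) n (by simp) (by simp),
        ShortComplex.moduleCat_exact_iff]
      exact h₃ n

end Resolution
end

/-! ### Vanishing of `Ext` along short exact sequences. -/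

noncomputable section
variable {R : Type u} [CommRing R]

/-- The modules `Ext^n_R(A, Y)` vanish for all `n ≥ 1`. -/
def ExtVanishes (A Y : ModuleCat.{u} R) : Prop :=
  ∀ n : ℕ, Subsingleton (Abelian.Ext A Y (n + 1))

section ExtSequences

variable {S : ShortComplex (ModuleCat.{u} R)}

theorem subsingleton_ext_of_retract {A B Y : ModuleCat.{u} R} (s : A ⟶ B) (r : B ⟶ A)
    (h : s ≫ r = 𝟙 A) (n : ℕ) [Subsingleton (Abelian.Ext B Y n)] :
    Subsingleton (Abelian.Ext A Y n) := by
  refine subsingleton_of_forall_eq 0 fun x => ?_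
  have hx : (Abelian.Ext.mk₀ s).comp ((Abelian.Ext.mk₀ r).comp x (zero_add n))
      (zero_add n) = x := by
    rw [Abelian.Ext.mk₀_comp_mk₀_assoc, h, Abelian.Ext.mk₀_id_comp]
  rw [← hx, Subsingleton.elim ((Abelian.Ext.mk₀ r).comp x (zero_add n)) 0, Abelian.Ext.comp_zero]

theorem exists_extension_of_ext_one (hS : S.ShortExact) (Y : ModuleCat.{u} R)
    [Subsingleton (Abelian.Ext S.X₃ Y 1)] (f : S.X₁ ⟶ Y) : ∃ g : S.X₂ ⟶ Y, S.f ≫ g = f := by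
  obtain ⟨x, hx⟩ := Abelian.Ext.contravariant_sequence_exact₁ hS Y (Abelian.Ext.mk₀ f)
    (add_zero 1) (Subsingleton.elim _ _)
  obtain ⟨g, rfl⟩ := (Abelian.Ext.mk₀_bijective _ _).2 x
  rw [Abelian.Ext.mk₀_comp_mk₀] at hx
  exact ⟨g, (Abelian.Ext.mk₀_bijective _ _).1 hx⟩

theorem subsingleton_ext_one_of_exists_extension (hS : S.ShortExact) (Y : ModuleCat.{u} R)
    [Subsingleton (Abelian.Ext S.X₂ Y 1)] (h : ∀ f : S.X₁ ⟶ Y, ∃ g : S.X₂ ⟶ Y, S.f ≫ g = f) :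
    Subsingleton (Abelian.Ext S.X₃ Y 1) := by
  refine subsingleton_of_forall_eq 0 fun x => ?_
  obtain ⟨y, rfl⟩ := Abelian.Ext.contravariant_sequence_exact₃ hS Y x (Subsingleton.elim _ _)
    (add_zero 1)
  obtain ⟨f, rfl⟩ := (Abelian.Ext.mk₀_bijective _ _).2 y
  obtain ⟨g, rfl⟩ := h f
  rw [← Abelian.Ext.mk₀_comp_mk₀, ← Abelian.Ext.comp_assoc_of_second_deg_zero, hS.extClass_comp,
    Abelian.Ext.zero_comp]

theorem subsingleton_ext_succ_X₃ (hS : S.ShortExact) (Y : ModuleCat.{u} R) (n : ℕ)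
    [Subsingleton (Abelian.Ext S.X₂ Y (n + 1))] [Subsingleton (Abelian.Ext S.X₁ Y n)] :
    Subsingleton (Abelian.Ext S.X₃ Y (n + 1)) := by
  refine subsingleton_of_forall_eq 0 fun x => ?_
  obtain ⟨y, rfl⟩ := Abelian.Ext.contravariant_sequence_exact₃ hS Y x (Subsingleton.elim _ _)
    (add_comm 1 n)
  rw [Subsingleton.elim y 0, Abelian.Ext.comp_zero]

theorem subsingleton_ext_X₁ (hS : S.ShortExact) (Y : ModuleCat.{u} R) (n : ℕ)
    [Subsingleton (Abelian.Ext S.X₂ Y n)] [Subsingleton (Abelian.Ext S.X₃ Y (n + 1))] :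
    Subsingleton (Abelian.Ext S.X₁ Y n) := by
  refine subsingleton_of_forall_eq 0 fun x => ?_
  obtain ⟨y, rfl⟩ := Abelian.Ext.contravariant_sequence_exact₁ hS Y x (add_comm 1 n)
    (Subsingleton.elim _ _)
  rw [Subsingleton.elim y 0, Abelian.Ext.comp_zero]

theorem subsingleton_ext_X₂ (hS : S.ShortExact) (Y : ModuleCat.{u} R) (n : ℕ)
    [Subsingleton (Abelian.Ext S.X₁ Y n)] [Subsingleton (Abelian.Ext S.X₃ Y n)] :
    Subsingleton (Abelian.Ext S.X₂ Y n) := by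
  refine subsingleton_of_forall_eq 0 fun x => ?_
  obtain ⟨y, rfl⟩ := Abelian.Ext.contravariant_sequence_exact₂ hS Y x (Subsingleton.elim _ _)
  rw [Subsingleton.elim y 0, Abelian.Ext.comp_zero]

theorem subsingleton_ext_covariant_X₃ (hS : S.ShortExact) (G : ModuleCat.{u} R) (n : ℕ)
    [Subsingleton (Abelian.Ext G S.X₂ n)] [Subsingleton (Abelian.Ext G S.X₁ (n + 1))] :
    Subsingleton (Abelian.Ext G S.X₃ n) := by
  refine subsingleton_of_forall_eq 0 fun x => ?_
  obtain ⟨y, rfl⟩ := Abelian.Ext.covariant_sequence_exact₃ G hS x rfl (Subsingleton.elim _ _)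
  rw [Subsingleton.elim y 0, Abelian.Ext.zero_comp]

theorem exists_lift_of_ext_one (hS : S.ShortExact) (G : ModuleCat.{u} R)
    [Subsingleton (Abelian.Ext G S.X₁ 1)] (f : G ⟶ S.X₃) : ∃ g : G ⟶ S.X₂, g ≫ S.g = f := by
  obtain ⟨x, hx⟩ := Abelian.Ext.covariant_sequence_exact₃ G hS (Abelian.Ext.mk₀ f)
    (zero_add 1) (Subsingleton.elim _ _)
  obtain ⟨g, rfl⟩ := (Abelian.Ext.mk₀_bijective _ _).2 x
  rw [Abelian.Ext.mk₀_comp_mk₀] at hx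
  exact ⟨g, (Abelian.Ext.mk₀_bijective _ _).1 hx⟩

theorem ExtVanishes.of_retract {A B Y : ModuleCat.{u} R} (hB : ExtVanishes B Y) (s : A ⟶ B)
    (r : B ⟶ A) (h : s ≫ r = 𝟙 A) : ExtVanishes A Y := fun n =>
  have := hB n
  subsingleton_ext_of_retract s r h _

theorem ExtVanishes.of_projective (P Y : ModuleCat.{u} R) [Projective P] : ExtVanishes P Y :=
  fun n => Abelian.Ext.subsingleton_of_projective P Y n

theorem ExtVanishes.X₁ {Y : ModuleCat.{u} R} (hS : S.ShortExact) (h₂ : ExtVanishes S.X₂ Y)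
    (h₃ : ExtVanishes S.X₃ Y) : ExtVanishes S.X₁ Y := fun n =>
  have := h₂ n
  have := h₃ (n + 1)
  subsingleton_ext_X₁ hS Y _

theorem ExtVanishes.X₂ {Y : ModuleCat.{u} R} (hS : S.ShortExact) (h₁ : ExtVanishes S.X₁ Y)
    (h₃ : ExtVanishes S.X₃ Y) : ExtVanishes S.X₂ Y := fun n =>
  have := h₁ n
  have := h₃ n
  subsingleton_ext_X₂ hS Y _

theorem ExtVanishes.X₃ {Y : ModuleCat.{u} R} (hS : S.ShortExact) (h₁ : ExtVanishes S.X₁ Y)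
    (h₂ : ExtVanishes S.X₂ Y) (h : ∀ f : S.X₁ ⟶ Y, ∃ g : S.X₂ ⟶ Y, S.f ≫ g = f) :
    ExtVanishes S.X₃ Y := by
  rintro (_ | n)
  · have := h₂ 0
    exact subsingleton_ext_one_of_exists_extension hS Y h
  · have := h₂ (n + 1)
    have := h₁ n
    exact subsingleton_ext_succ_X₃ hS Y _

theorem ExtVanishes.covariant_X₃ {G : ModuleCat.{u} R} (hS : S.ShortExact)
    (h₁ : ExtVanishes G S.X₁) (h₂ : ExtVanishes G S.X₂) : ExtVanishes G S.X₃ := fun n =>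
  have := h₂ n
  have := h₁ (n + 1)
  subsingleton_ext_covariant_X₃ hS G _

end ExtSequences

/-- Dimension shifting along a family of short exact sequences
`0 → Z (s i) → F i → Z i → 0`. -/
theorem extVanishes_of_family {ι : Type*} (s : ι → ι) (S : ι → ShortComplex (ModuleCat.{u} R))
    (hS : ∀ i, (S i).ShortExact) (hs : ∀ i, (S i).X₁ = (S (s i)).X₃) (Y : ModuleCat.{u} R)
    (h₂ : ∀ i, ExtVanishes (S i).X₂ Y)
    (h : ∀ i, ∀ f : (S i).X₁ ⟶ Y, ∃ g : (S i).X₂ ⟶ Y, (S i).f ≫ g = f) (i : ι) :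
    ExtVanishes (S i).X₃ Y := by
  intro n
  induction n generalizing i with
  | zero =>
    have := h₂ i 0
    exact subsingleton_ext_one_of_exists_extension (hS i) Y (h i)
  | succ n ih =>
    have := h₂ i (n + 1)
    have := ih (s i)
    rw [← hs i] at this
    exact subsingleton_ext_succ_X₃ (hS i) Y _

/-- The short complex given by two composable linear maps. -/
abbrev mkShort {A B D : Type u} [AddCommGroup A] [Module R A] [AddCommGroup B] [Module R B]
    [AddCommGroup D] [Module R D] (f : A →ₗ[R] B) (g : B →ₗ[R] D) (h : Function.Exact f g) :
    ShortComplex (ModuleCat.{u} R) :=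
  ShortComplex.mk (ModuleCat.ofHom f) (ModuleCat.ofHom g)
    (ModuleCat.hom_ext (LinearMap.ext fun x => h.apply_apply_eq_zero x))

theorem mkShort_shortExact {A B D : Type u} [AddCommGroup A] [Module R A] [AddCommGroup B]
    [Module R B] [AddCommGroup D] [Module R D] {f : A →ₗ[R] B} {g : B →ₗ[R] D}
    (h : Function.Exact f g) (hf : Function.Injective f) (hg : Function.Surjective g) :
    (mkShort f g h).ShortExact where
  exact := (ShortComplex.moduleCat_exact_iff _).2 fun x hx => (h x).1 hx
  mono_f := (ModuleCat.mono_iff_injective _).2 hf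
  epi_g := (ModuleCat.epi_iff_surjective _).2 hg

theorem exact_of_shortExact {S : ShortComplex (ModuleCat.{u} R)} (hS : S.ShortExact) :
    Function.Exact S.f.hom S.g.hom :=
  (ShortComplex.ShortExact.moduleCat_exact_iff_function_exact S).1 hS.exact

/-- Tensor a projective presentation of `B` with the flat module `P` and shift dimensions. In the
base case a map `P ⊗ K → Y` is the same as `P → Hom(K, Y)`, which lifts to `Hom(F, Y)` because
`Ext^1(B, Y) = 0` and `P` is projective. -/
theorem ExtVanishes.tensor {B Y : ModuleCat.{u} R} (P : ModuleCat.{u} R) [Module.Projective R P]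
    (hB : ExtVanishes B Y) : ExtVanishes (ModuleCat.of R (TensorProduct R P B)) Y := by
  intro n
  induction n generalizing B with
  | zero =>
    have hS := B.shortExact_projectiveShortComplex
    have hex := exact_of_shortExact hS
    have hS' := mkShort_shortExact (lTensor_exact P hex hS.moduleCat_surjective_g)
      (Module.Flat.lTensor_preserves_injective_linearMap _ hS.moduleCat_injective_f)
      (LinearMap.lTensor_surjective _ hS.moduleCat_surjective_g)
    have : Projective (ModuleCat.of R (TensorProduct R P B.projectiveShortComplex.X₂)) :=
      ModuleCat.projective_of_categoryTheory_projective _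
    have : Subsingleton (Abelian.Ext (ModuleCat.of R
        (TensorProduct R P B.projectiveShortComplex.X₂)) Y 1) :=
      ExtVanishes.of_projective _ Y 0
    refine subsingleton_ext_one_of_exists_extension hS' Y fun f => ?_
    have hsurj : Function.Surjective
        (LinearMap.lcomp R Y B.projectiveShortComplex.f.hom) := by
      intro φ
      have := hB 0
      obtain ⟨g, hg⟩ := exists_extension_of_ext_one hS Y (ModuleCat.ofHom φ)
      exact ⟨g.hom, congr(($hg).hom)⟩
    obtain ⟨G, hG⟩ := Module.projective_lifting_property _ (TensorProduct.curry f.hom) hsurj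
    refine ⟨ModuleCat.ofHom (TensorProduct.lift G), ?_⟩
    ext : 1
    refine TensorProduct.ext' fun p x => ?_
    exact congr($hG p x)
  | succ n ih =>
    have hS := B.shortExact_projectiveShortComplex
    have hex := exact_of_shortExact hS
    have hS' := mkShort_shortExact (lTensor_exact P hex hS.moduleCat_surjective_g)
      (Module.Flat.lTensor_preserves_injective_linearMap _ hS.moduleCat_injective_f)
      (LinearMap.lTensor_surjective _ hS.moduleCat_surjective_g)
    have : Projective (ModuleCat.of R (TensorProduct R P B.projectiveShortComplex.X₂)) :=
      ModuleCat.projective_of_categoryTheory_projective _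
    have hp : Projective B.projectiveShortComplex.X₂ :=
      ModuleCat.projective_of_categoryTheory_projective _
    have : Subsingleton (Abelian.Ext (ModuleCat.of R
        (TensorProduct R P B.projectiveShortComplex.X₂)) Y (n + 1 + 1)) :=
      ExtVanishes.of_projective _ Y _
    have := ih (ExtVanishes.X₁ hS (ExtVanishes.of_projective _ Y) hB)
    exact subsingleton_ext_succ_X₃ hS' Y _

end

/-! ### `C`-projective modules. -/

noncomputable section
variable {R : Type u} [CommRing R] {C : ModuleCat.{u} R}

open TensorProduct

theorem IsSemidualizing.finite (hC : IsSemidualizing C) : Module.Finite R C := by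
  obtain ⟨F⟩ := hC.resolution
  have := (F.mem 0).2
  exact Module.Finite.of_surjective F.π.hom ((Resolution.acyclic_augment_iff _ _ _).1 F.acyclic).1

/-- A linear map from a finite module to a direct sum has values in a finite partial sum. -/
theorem exists_finset_forall_notMem_eq_zero {ι A N : Type*} [AddCommGroup A] [Module R A]
    [AddCommGroup N] [Module R N] [Module.Finite R A] (f : A →ₗ[R] (ι →₀ N)) :
    ∃ T : Finset ι, ∀ a, ∀ i ∉ T, f a i = 0 := by
  classical
  obtain ⟨t, ht⟩ := Module.Finite.fg_top (R := R) (M := A)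
  have h : LinearMap.range f ≤ Finsupp.supported N R
      (t.biUnion fun a => (f a).support : Finset ι) := by
    rw [LinearMap.range_eq_map, ← ht, Submodule.map_span, Submodule.span_le]
    rintro _ ⟨a, ha, rfl⟩
    rw [SetLike.mem_coe, Finsupp.mem_supported]
    exact_mod_cast Finset.subset_biUnion_of_mem (fun a => (f a).support) ha
  exact ⟨_, fun a i hi => by_contra fun h' =>
    hi ((Finsupp.mem_supported _ _).1 (h ⟨a, rfl⟩) (Finsupp.mem_support_iff.2 h'))⟩

theorem PC.exists_retract {Y : ModuleCat.{u} R} (hY : PC C Y) :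
    ∃ (ι : Type u) (s : Y →ₗ[R] (ι →₀ C)) (r : (ι →₀ C) →ₗ[R] Y), r ∘ₗ s = LinearMap.id := by
  classical
  obtain ⟨P, hP, ⟨e⟩⟩ := hY
  obtain ⟨s, hs⟩ := Module.projective_def'.1 hP
  let E := TensorProduct.finsuppScalarLeft R C P
  refine ⟨P, E.toLinearMap ∘ₗ s.rTensor C ∘ₗ e.toLinearMap,
    e.symm.toLinearMap ∘ₗ (Finsupp.linearCombination R id).rTensor C ∘ₗ E.symm.toLinearMap, ?_⟩
  ext x
  have := congr(($hs).rTensor C (e x))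
  rw [LinearMap.rTensor_comp, LinearMap.rTensor_id] at this
  simpa using congr(e.symm $this)

/-- `Y` is a retract of some `C^(ι)`, and a map from the finite module `A` into `C^(ι)` has finitely
many nonzero coordinates, so it extends coordinatewise. This passes from the single target `C` to
all of `PC`. -/
theorem exists_extension_of_PC {A E Y : ModuleCat.{u} R} [Module.Finite R A] (i : A →ₗ[R] E)
    (h : ∀ f : A →ₗ[R] C, ∃ g : E →ₗ[R] C, g ∘ₗ i = f) (hY : PC C Y) (f : A →ₗ[R] Y) :
    ∃ g : E →ₗ[R] Y, g ∘ₗ i = f := by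
  obtain ⟨ι, s, r, hrs⟩ := hY.exists_retract
  obtain ⟨T, hT⟩ := exists_finset_forall_notMem_eq_zero (s ∘ₗ f)
  choose g hg using fun j => h (Finsupp.lapply j ∘ₗ s ∘ₗ f)
  refine ⟨r ∘ₗ ∑ j ∈ T, Finsupp.lsingle j ∘ₗ g j, ?_⟩
  ext a
  have h₁ : ∑ j ∈ T, Finsupp.single j (g j (i a)) = s (f a) := by
    classical
    ext k
    have (j : ι) : g j (i a) = s (f a) j := congr($(hg j) a)
    simp only [this, Finsupp.coe_finsetSum, Finset.sum_apply, Finsupp.single_apply,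
      Finset.sum_ite_eq']
    split_ifs with hk
    · rfl
    · exact (hT a k hk).symm
  have h₂ := congr(r $h₁).trans congr($hrs (f a))
  simpa using h₂

theorem IsSemidualizing.exists_smul_eq (hC : IsSemidualizing C) (f : C →ₗ[R] C) :
    ∃ r : R, ∀ c, f c = r • c := by
  obtain ⟨r, rfl⟩ := hC.homothety.2 f
  exact ⟨r, fun c => rfl⟩

theorem IsSemidualizing.eq_zero_of_forall_smul (hC : IsSemidualizing C) {r : R}
    (h : ∀ c : C, r • c = 0) : r = 0 :=
  hC.homothety.1 (LinearMap.ext fun c => (h c).trans (by simp))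

/-- The canonical isomorphism `R^(ι) ≃ Hom(C, C^(ι))` for a semidualizing module `C`. -/
def IsSemidualizing.finsuppEquiv (hC : IsSemidualizing C) (ι : Type u) :
    (ι →₀ R) ≃ₗ[R] (C →ₗ[R] (ι →₀ C)) := by
  classical
  refine LinearEquiv.ofBijective (TensorProduct.curry
    (TensorProduct.finsuppScalarLeft R C ι).toLinearMap) ⟨?_, ?_⟩
  · rw [← LinearMap.ker_eq_bot, LinearMap.ker_eq_bot']
    intro x hx
    ext i
    refine hC.eq_zero_of_forall_smul fun c => ?_
    exact (TensorProduct.finsuppScalarLeft_apply_tmul_apply x c i).symm.trans congr($hx c i)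
  · intro f
    have := hC.finite
    obtain ⟨T, hT⟩ := exists_finset_forall_notMem_eq_zero f
    choose r hr using fun i => hC.exists_smul_eq (Finsupp.lapply i ∘ₗ f)
    refine ⟨Finsupp.onFinset T r fun i hi => by_contra fun hiT => hi ?_, ?_⟩
    · exact hC.eq_zero_of_forall_smul fun c => (hr i c).symm.trans (hT c i hiT)
    · ext c i
      simpa using (hr i c).symm

/-- The evaluation map `Hom(C, A) ⊗ C → A`. -/
abbrev evalMap (C A : Type u) [AddCommGroup C] [Module R C] [AddCommGroup A] [Module R A] :
    (C →ₗ[R] A) ⊗[R] C →ₗ[R] A :=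
  TensorProduct.lift LinearMap.id

theorem IsSemidualizing.evalMap_finsupp_bijective (hC : IsSemidualizing C) (ι : Type u) :
    Function.Bijective (evalMap (R := R) C (ι →₀ C)) := by
  classical
  have : evalMap C (ι →₀ C) ∘ₗ ((hC.finsuppEquiv ι).rTensor C).toLinearMap =
      (TensorProduct.finsuppScalarLeft R C ι).toLinearMap :=
    TensorProduct.ext' fun x c => rfl
  have h : Function.Bijective (evalMap (R := R) C (ι →₀ C) ∘ (hC.finsuppEquiv ι).rTensor C) := by
    have h := (TensorProduct.finsuppScalarLeft R C ι).bijective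
    have h' : ⇑(TensorProduct.finsuppScalarLeft R C ι) =
      evalMap (R := R) C (ι →₀ C) ∘ (hC.finsuppEquiv ι).rTensor C := congr(⇑$this).symm
    rwa [h'] at h
  exact (Function.Bijective.of_comp_iff _ (LinearEquiv.bijective _)).1 h

theorem evalMap_natural {A B : Type u} [AddCommGroup A] [Module R A] [AddCommGroup B] [Module R B]
    (f : A →ₗ[R] B) (t : (C →ₗ[R] A) ⊗[R] C) :
    evalMap C B ((LinearMap.compRight R f).rTensor C t) = f (evalMap C A t) := by
  induction t with
  | zero => simp
  | add x y hx hy => simp only [map_add, hx, hy]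
  | tmul g c => rfl

/-- `A` is recovered as `Hom(C, A) ⊗ C`. The module `Hom(C, A)` is a retract of `Hom(C, C^(ι)) ≅
R^(ι)`, hence projective, and bijectivity of evaluation passes from `C^(ι)` to its retract `A` by
naturality. -/
theorem PC.of_retract (hC : IsSemidualizing C) {A Y : ModuleCat.{u} R} (hY : PC C Y)
    (s : A →ₗ[R] Y) (r : Y →ₗ[R] A) (h : r ∘ₗ s = LinearMap.id) : PC C A := by
  obtain ⟨ι, s', r', h'⟩ := hY.exists_retract
  obtain ⟨s, r, h⟩ : ∃ (s : A →ₗ[R] (ι →₀ C)) (r : (ι →₀ C) →ₗ[R] A), r ∘ₗ s = LinearMap.id :=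
    ⟨s' ∘ₗ s, r ∘ₗ r', by
      rw [LinearMap.comp_assoc, ← LinearMap.comp_assoc s, h', LinearMap.id_comp, h]⟩
  have hrs (x : A) : r (s x) = x := congr($h x)
  have hfree : Module.Projective R (C →ₗ[R] (ι →₀ C)) :=
    Module.Projective.of_equiv (hC.finsuppEquiv ι)
  have hcomp : LinearMap.compRight R r ∘ₗ LinearMap.compRight R s =
      (LinearMap.id : (C →ₗ[R] A) →ₗ[R] _) := by
    ext f c
    exact hrs _
  refine ⟨ModuleCat.of R (C →ₗ[R] A), Module.Projective.of_split _ _ hcomp,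
    ⟨(LinearEquiv.ofBijective (evalMap (R := R) C A) ⟨?_, ?_⟩).symm⟩⟩
  · rw [← LinearMap.ker_eq_bot, LinearMap.ker_eq_bot']
    intro t ht
    have h₁ : (LinearMap.compRight R s).rTensor C t = 0 :=
      (hC.evalMap_finsupp_bijective ι).1 (by rw [evalMap_natural, ht, map_zero, map_zero])
    have h₂ := congr((LinearMap.compRight R r).rTensor C $h₁)
    rwa [map_zero, ← LinearMap.comp_apply, ← LinearMap.rTensor_comp, hcomp, LinearMap.rTensor_id,
      LinearMap.id_apply] at h₂
  · intro a
    obtain ⟨t, ht⟩ := (hC.evalMap_finsupp_bijective ι).2 (s a)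
    exact ⟨(LinearMap.compRight R r).rTensor C t, by rw [evalMap_natural, ht, hrs]⟩

theorem PC.of_linearEquiv {A Y : ModuleCat.{u} R} (hY : PC C Y) (e : A ≃ₗ[R] Y) : PC C A := by
  obtain ⟨P, hP, ⟨e'⟩⟩ := hY
  exact ⟨P, hP, ⟨e.trans e'⟩⟩

theorem PC.self (C : ModuleCat.{u} R) : PC C C :=
  ⟨ModuleCat.of R R, Module.Projective.of_free, ⟨(TensorProduct.lid R C).symm⟩⟩

theorem PC.of_subsingleton (C A : ModuleCat.{u} R) [Subsingleton A] : PC C A := by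
  have : Subsingleton (TensorProduct R PUnit.{u+1} C) :=
    subsingleton_of_forall_eq 0 fun x => by
      induction x with
      | zero => rfl
      | add x y hx hy => rw [hx, hy, add_zero]
      | tmul x y => rw [Subsingleton.elim x 0, TensorProduct.zero_tmul]
  exact ⟨ModuleCat.of R PUnit, Module.Projective.of_free, ⟨LinearEquiv.ofSubsingleton _ _⟩⟩

theorem PC.prod {U V : ModuleCat.{u} R} (hU : PC C U) (hV : PC C V) :
    PC C (ModuleCat.of R (U × V)) := by
  obtain ⟨P, hP, ⟨e⟩⟩ := hU
  obtain ⟨Q, hQ, ⟨e'⟩⟩ := hV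
  exact ⟨ModuleCat.of R (P × Q), inferInstance,
    ⟨(e.prodCongr e').trans (TensorProduct.prodLeft R R P Q C).symm⟩⟩

theorem PC.hom_of_finiteFree (C F : ModuleCat.{u} R) [Module.Free R F] [Module.Finite R F] :
    PC C (ModuleCat.of R (F →ₗ[R] C)) :=
  ⟨ModuleCat.of R (Module.Dual R F), Module.Projective.of_free,
    ⟨(dualTensorHomEquiv R F C).symm⟩⟩

variable [IsLocalRing R]

/-- The endomorphism `c' ↦ f c' • c` is a homothety by some `r`, and `r (f c - r)` annihilates `C`.
If `f c` were a unit, one factor would be a unit by locality, which forces `r = f c`. Then `c`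
freely generates `C`, against `C ≇ R`. -/
theorem IsSemidualizing.apply_mem_maximalIdeal (hC : IsSemidualizing C)
    (hCR : IsEmpty (C ≃ₗ[R] R)) (f : C →ₗ[R] R) (c : C) :
    f c ∈ IsLocalRing.maximalIdeal R := by
  by_contra hu
  rw [IsLocalRing.mem_maximalIdeal, mem_nonunits_iff, not_not] at hu
  obtain ⟨r, hr⟩ := hC.exists_smul_eq (f.smulRight c)
  simp only [LinearMap.smulRight_apply] at hr
  have hrr : r * (f c - r) = 0 := hC.eq_zero_of_forall_smul fun c' => by
    rw [mul_comm, mul_smul, sub_smul, ← hr, sub_eq_zero, ← hr, map_smul, smul_eq_mul, smul_smul,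
      mul_comm]
  have hrc : r = f c := by
    have hsum : IsUnit (r + (f c - r)) := by rwa [add_sub_cancel]
    rcases IsLocalRing.isUnit_or_isUnit_of_isUnit_add hsum with h | h
    · exact (sub_eq_zero.1 (h.mul_right_eq_zero.1 hrr)).symm
    · have hr0 : r = 0 := h.mul_left_eq_zero.1 hrr
      have hc : f c • c = 0 := by rw [hr, hr0, zero_smul]
      rw [hu.smul_eq_zero.1 hc, map_zero] at hu
      exact absurd hu not_isUnit_zero
  rw [hrc] at hr
  refine hCR.false (LinearEquiv.ofBijective (LinearMap.toSpanSingleton R C c) ⟨?_, ?_⟩).symm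
  · rw [← LinearMap.ker_eq_bot, LinearMap.ker_eq_bot']
    intro a ha
    have := congr(f $ha)
    rw [LinearMap.toSpanSingleton_apply, map_smul, map_zero, smul_eq_mul] at this
    exact hu.mul_left_eq_zero.1 this
  · intro c'
    obtain ⟨v, hv⟩ := hu.exists_left_inv
    refine ⟨v * f c', ?_⟩
    rw [LinearMap.toSpanSingleton_apply, mul_smul, hr, smul_smul, hv, one_smul]

theorem PC.apply_mem_maximalIdeal (hC : IsSemidualizing C) (hCR : IsEmpty (C ≃ₗ[R] R))
    {U : ModuleCat.{u} R} (hU : PC C U) (f : U →ₗ[R] R) (x : U) :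
    f x ∈ IsLocalRing.maximalIdeal R := by
  obtain ⟨P, hP, ⟨e⟩⟩ := hU
  obtain ⟨t, rfl⟩ := e.symm.surjective x
  induction t with
  | zero => simp
  | add x y hx hy => rw [map_add, map_add]; exact add_mem hx hy
  | tmul p c =>
    exact hC.apply_mem_maximalIdeal hCR (f ∘ₗ e.symm.toLinearMap ∘ₗ TensorProduct.mk R P C p) c

end

/-! ### Syzygies of a semidualizing module and their `C`-duals. -/

noncomputable section
variable {R : Type u} [CommRing R] {C : ModuleCat.{u} R}

theorem exists_comp_eq_of_ker_le {A B D : Type*} [AddCommGroup A] [Module R A] [AddCommGroup B]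
    [Module R B] [AddCommGroup D] [Module R D] {p : A →ₗ[R] B} (hp : Function.Surjective p)
    (f : A →ₗ[R] D) (h : ∀ x, p x = 0 → f x = 0) : ∃ g : B →ₗ[R] D, ∀ x, g (p x) = f x := by
  refine ⟨(LinearMap.ker p).liftQ f (fun x hx => h x hx) ∘ₗ
    (p.quotKerEquivOfSurjective hp).symm.toLinearMap, fun x => ?_⟩
  have : (p.quotKerEquivOfSurjective hp).symm (p x) = Submodule.Quotient.mk x := by
    rw [LinearEquiv.symm_apply_eq]; rfl
  simp only [LinearMap.comp_apply, LinearEquiv.coe_coe, this]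
  rfl

section Syzygies

variable {α : Type*} [AddRightCancelSemigroup α] [One α] (K : ChainComplex (ModuleCat.{u} R) α)

/-- The cokernel of the differential of a chain complex with target in degree `i`. -/
abbrev cokerD (i : α) : ModuleCat.{u} R :=
  ModuleCat.of R (K.X i ⧸ LinearMap.range (K.d (i + 1) i).hom)

/-- The map from `Coker ∂_{i+2}` to `K_i` induced by the differential `∂_{i+1}`. -/
def cokerDMap (i : α) : cokerD K (i + 1) →ₗ[R] K.X i :=
  (LinearMap.range (K.d (i + 1 + 1) (i + 1)).hom).liftQ (K.d (i + 1) i).hom (by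
    rintro _ ⟨x, rfl⟩
    exact congr(($(K.d_comp_d (i + 1 + 1) (i + 1) i)).hom x))

theorem cokerDMap_exact (i : α) : Function.Exact (cokerDMap K i)
    (LinearMap.range (K.d (i + 1) i).hom).mkQ := by
  intro x
  rw [Submodule.mkQ_apply, Submodule.Quotient.mk_eq_zero]
  constructor
  · rintro ⟨y, rfl⟩
    exact ⟨Submodule.Quotient.mk y, rfl⟩
  · rintro ⟨y, rfl⟩
    obtain ⟨y, rfl⟩ := Submodule.Quotient.mk_surjective _ y
    exact ⟨y, rfl⟩

variable {K}

theorem cokerDMap_injective (i : α) (h : ∀ x : K.X (i + 1), K.d (i + 1) i x = 0 →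
    ∃ y, K.d (i + 1 + 1) (i + 1) y = x) : Function.Injective (cokerDMap K i) := by
  rw [← LinearMap.ker_eq_bot, LinearMap.ker_eq_bot']
  intro x hx
  obtain ⟨x, rfl⟩ := Submodule.Quotient.mk_surjective _ x
  obtain ⟨y, rfl⟩ := h x hx
  exact (Submodule.Quotient.mk_eq_zero _).2 ⟨y, rfl⟩

theorem exists_extension_cokerDMap (i : α) {Y : ModuleCat.{u} R}
    (h : ∀ f : K.X (i + 1) ⟶ Y, K.d (i + 1 + 1) (i + 1) ≫ f = 0 →
      ∃ g : K.X i ⟶ Y, K.d (i + 1) i ≫ g = f) (f : cokerD K (i + 1) →ₗ[R] Y) :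
    ∃ g : K.X i →ₗ[R] Y, g ∘ₗ cokerDMap K i = f := by
  obtain ⟨g, hg⟩ := h (ModuleCat.ofHom (f ∘ₗ Submodule.mkQ _)) (by
    ext x
    have hx : (LinearMap.range (K.d (i + 1 + 1) (i + 1)).hom).mkQ (K.d (i + 1 + 1) (i + 1) x) = 0 :=
      (Submodule.Quotient.mk_eq_zero _).2 (LinearMap.mem_range_self _ x)
    exact congr(f $hx).trans f.map_zero)
  refine ⟨g.hom, LinearMap.ext fun x => ?_⟩
  obtain ⟨x, rfl⟩ := Submodule.Quotient.mk_surjective _ x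
  exact congr(($hg).hom x)

/-- Vanishing of `Ext` for all cokernels of an exact complex `K` with `Hom(K, Y)` exact whose
terms have vanishing `Ext`. -/
theorem extVanishes_cokerD {Y : ModuleCat.{u} R}
    (hK : ∀ i, ∀ x : K.X (i + 1), K.d (i + 1) i x = 0 → ∃ y, K.d (i + 1 + 1) (i + 1) y = x)
    (hX : ∀ i, ExtVanishes (K.X i) Y)
    (hY : ∀ i, ∀ f : cokerD K (i + 1) →ₗ[R] Y, ∃ g : K.X i →ₗ[R] Y, g ∘ₗ cokerDMap K i = f)
    (i : α) : ExtVanishes (cokerD K i) Y :=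
  extVanishes_of_family (· + 1) (fun i => mkShort _ _ (cokerDMap_exact K i))
    (fun i => mkShort_shortExact _ (cokerDMap_injective i (hK i)) (Submodule.mkQ_surjective _))
    (fun _ => rfl) Y hX (fun i f => by
      obtain ⟨g, hg⟩ := hY i f.hom
      exact ⟨ModuleCat.ofHom g, ModuleCat.hom_ext hg⟩) i

end Syzygies

theorem ExtVanishes.of_linearEquiv {A B Y : ModuleCat.{u} R} (hB : ExtVanishes B Y)
    (e : A ≃ₗ[R] B) : ExtVanishes A Y :=
  hB.of_retract e.toModuleIso.hom e.toModuleIso.inv e.toModuleIso.hom_inv_id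

namespace Resolution

variable {𝒳 : ObjectProperty (ModuleCat.{u} R)} {M : ModuleCat.{u} R} (X : Resolution 𝒳 M)

theorem surjective_π : Function.Surjective X.π :=
  ((acyclic_augment_iff _ _ _).1 X.acyclic).1

theorem exists_of_π_eq_zero (x : X.complex.X 0) (h : X.π x = 0) : ∃ y, X.complex.d 1 0 y = x :=
  ((acyclic_augment_iff _ _ _).1 X.acyclic).2.1 x h

theorem exists_of_d_eq_zero (n : ℕ) (x : X.complex.X (n + 1)) (h : X.complex.d (n + 1) n x = 0) :
    ∃ y, X.complex.d (n + 2) (n + 1) y = x :=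
  ((acyclic_augment_iff _ _ _).1 X.acyclic).2.2 n x h

theorem exact_d_π : Function.Exact (X.complex.d 1 0).hom X.π.hom := fun x =>
  ⟨X.exists_of_π_eq_zero x, by rintro ⟨y, rfl⟩; exact congr(($(X.d_comp_π)).hom y)⟩

/-- The zeroth cokernel of a resolution of `M` is `M`. -/
def cokerDZeroEquiv : cokerD X.complex 0 ≃ₗ[R] M :=
  (Submodule.quotEquivOfEq _ _ X.exact_d_π.linearMap_ker_eq.symm).trans
    (X.π.hom.quotKerEquivOfSurjective X.surjective_π)

end Resolution

theorem projective_of_finiteFree {F : ModuleCat.{u} R} (h : finiteFree R F) : Projective F :=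
  have := h.1
  have : Module.Projective R F := Module.Projective.of_free
  ModuleCat.projective_of_categoryTheory_projective F

theorem subsingleton_Ext_iff {𝒳 : ObjectProperty (ModuleCat.{u} R)} {M : ModuleCat.{u} R}
    (X : Resolution 𝒳 M) (h : ∀ n, Projective (X.complex.X n)) (N : ModuleCat.{u} R) (n : ℕ) :
    Subsingleton (((Ext R (ModuleCat.{u} R) (n + 1)).obj (Opposite.op M)).obj N) ↔
      ∀ f : X.complex.X (n + 1) ⟶ N, X.complex.d (n + 2) (n + 1) ≫ f = 0 →
        ∃ g : X.complex.X n ⟶ N, X.complex.d (n + 1) n ≫ g = f := by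
  rw [← linearYonedaObj_homology_subsingleton_iff]
  exact ((X.toProjectiveResolution h).isoExt (n + 1) N).toLinearEquiv.toEquiv.subsingleton_congr

theorem dual_exact (F : Resolution (finiteFree R) C) (n : ℕ) :
    Function.Exact (LinearMap.lcomp R C (LinearMap.range (F.complex.d (n + 1) n).hom).mkQ)
      (LinearMap.lcomp R C (cokerDMap F.complex n)) :=
  LinearMap.exact_lcomp_of_exact_of_surjective _ (cokerDMap_exact F.complex n)
    (Submodule.mkQ_surjective _)

section Semidualizing

variable (hC : IsSemidualizing C) (F : Resolution (finiteFree R) C)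
include hC

theorem IsSemidualizing.exists_extension_self (n : ℕ) (f : cokerD F.complex (n + 1) →ₗ[R] C) :
    ∃ g : F.complex.X n →ₗ[R] C, g ∘ₗ cokerDMap F.complex n = f :=
  exists_extension_cokerDMap n ((subsingleton_Ext_iff F
    (fun n => projective_of_finiteFree (F.mem n)) C n).1 (hC.ext_self (n + 1) (by simp))) f

/-- The syzygies are finite, so extension of maps into `C`, which is `Ext(C, C) = 0`, upgrades to
extension of maps into any `C`-projective module. -/
theorem IsSemidualizing.extVanishes_cokerD {Y : ModuleCat.{u} R} (hY : PC C Y) (n : ℕ) :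
    ExtVanishes (cokerD F.complex n) Y := by
  refine RelCoh.extVanishes_cokerD F.exists_of_d_eq_zero (fun i => ?_) (fun i => ?_) n
  · have := projective_of_finiteFree (F.mem i)
    exact ExtVanishes.of_projective _ _
  · have := (F.mem (i + 1)).2
    exact exists_extension_of_PC (A := cokerD F.complex (i + 1)) _
      (hC.exists_extension_self F i) hY

theorem IsSemidualizing.extVanishes {Y : ModuleCat.{u} R} (hY : PC C Y) : ExtVanishes C Y := by
  obtain ⟨F⟩ := hC.resolution
  exact (hC.extVanishes_cokerD F hY 0).of_linearEquiv F.cokerDZeroEquiv.symm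

theorem IsSemidualizing.extVanishes_of_PC {U Y : ModuleCat.{u} R} (hU : PC C U) (hY : PC C Y) :
    ExtVanishes U Y := by
  obtain ⟨P, hP, ⟨e⟩⟩ := hU
  exact ((hC.extVanishes hY).tensor P).of_linearEquiv (B := ModuleCat.of R _) e

/-- As `Hom(C, C)` consists of homotheties, a functional on it is evaluation at its value on the
identity. -/
theorem IsSemidualizing.bidual_bijective :
    Function.Bijective (LinearMap.applyₗ : C →ₗ[R] (C →ₗ[R] C) →ₗ[R] C) := by
  constructor
  · intro c c' h
    exact congr($h LinearMap.id)
  · intro θ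
    refine ⟨θ LinearMap.id, LinearMap.ext fun φ => ?_⟩
    obtain ⟨r, rfl⟩ := hC.homothety.2 φ
    have : LinearMap.lsmul R C r = r • LinearMap.id := by ext; rfl
    rw [this, map_smul, map_smul]
    rfl

theorem IsSemidualizing.bidual_bijective_of_finiteFree {F : ModuleCat.{u} R} [Module.Free R F]
    [Module.Finite R F] :
    Function.Bijective (LinearMap.applyₗ : F →ₗ[R] (F →ₗ[R] C) →ₗ[R] C) := by
  classical
  let b := Module.Free.chooseBasis R F
  constructor
  · rw [← LinearMap.ker_eq_bot, LinearMap.ker_eq_bot']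
    intro x hx
    refine b.ext_elem fun i => ?_
    rw [map_zero, Finsupp.zero_apply]
    exact hC.eq_zero_of_forall_smul fun c => congr($hx ((b.coord i).smulRight c))
  · intro θ
    choose r hr using fun i => hC.exists_smul_eq
      (θ ∘ₗ LinearMap.smulRightₗ (b.coord i))
    refine ⟨∑ i, r i • b i, LinearMap.ext fun φ => ?_⟩
    have hφ : φ = ∑ i, (b.coord i).smulRight (φ (b i)) := by
      refine b.ext fun j => ?_
      simp [Finsupp.single_apply]
    conv_rhs => rw [hφ, map_sum]
    simp only [map_sum, map_smul, LinearMap.sum_apply, LinearMap.smul_apply,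
      LinearMap.applyₗ_apply_apply]
    exact Finset.sum_congr rfl fun i _ => (hr i (φ (b i))).symm

/-- Reflexivity with respect to `C` holds for `C` and for finite free modules. It descends to the
kernel of `F_n → Ω_n` by a diagram chase, since functionals on that kernel extend to `F_n`. -/
theorem IsSemidualizing.bidual_bijective_cokerD (n : ℕ) : Function.Bijective
    (LinearMap.applyₗ : cokerD F.complex n →ₗ[R] (cokerD F.complex n →ₗ[R] C) →ₗ[R] C) := by
  induction n with
  | zero =>
    have h := hC.bidual_bijective
    let e := F.cokerDZeroEquiv
    constructor
    · intro x y hxy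
      refine e.injective (h.1 (LinearMap.ext fun φ => ?_))
      exact congr($hxy (φ ∘ₗ e.toLinearMap))
    · intro θ
      obtain ⟨c, hc⟩ := h.2 (θ ∘ₗ LinearMap.lcomp R C e.toLinearMap)
      refine ⟨e.symm c, LinearMap.ext fun φ => ?_⟩
      have h₁ := congr($hc (φ ∘ₗ e.symm.toLinearMap))
      have h₂ : LinearMap.lcomp R C e.toLinearMap (φ ∘ₗ e.symm.toLinearMap) = φ := by
        exact LinearMap.ext fun x => congr(φ $(e.symm_apply_apply x))
      rw [LinearMap.comp_apply, h₂] at h₁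
      exact h₁
  | succ n ih =>
    have := (F.mem n).1
    have := (F.mem n).2
    have hF := hC.bidual_bijective_of_finiteFree (F := F.complex.X n)
    have hinj := cokerDMap_injective n (F.exists_of_d_eq_zero n)
    constructor
    · intro x y hxy
      refine hinj (hF.1 (LinearMap.ext fun φ => ?_))
      exact congr($hxy (φ ∘ₗ cokerDMap F.complex n))
    · intro θ
      obtain ⟨x, hx⟩ := hF.2 (θ ∘ₗ LinearMap.lcomp R C (cokerDMap F.complex n))
      have hx0 : (LinearMap.range (F.complex.d (n + 1) n).hom).mkQ x = 0 := by
        refine ih.1 (LinearMap.ext fun ψ => ?_)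
        have h₁ := congr($hx (ψ ∘ₗ Submodule.mkQ _))
        have h₂ : LinearMap.lcomp R C (cokerDMap F.complex n) (ψ ∘ₗ Submodule.mkQ _) = 0 := by
          rw [LinearMap.lcomp_apply', LinearMap.comp_assoc,
            (cokerDMap_exact F.complex n).linearMap_comp_eq_zero, LinearMap.comp_zero]
        rw [LinearMap.comp_apply, h₂, map_zero] at h₁
        rw [map_zero]
        exact h₁
      obtain ⟨z, rfl⟩ := (cokerDMap_exact F.complex n x).1 hx0
      refine ⟨z, LinearMap.ext fun φ => ?_⟩
      obtain ⟨g, rfl⟩ := hC.exists_extension_self F n φ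
      exact congr($hx g)

/-- The endomorphisms of a semidualizing module, as duals of the zeroth cokernel. -/
def IsSemidualizing.dualCokerDZeroEquiv : (cokerD F.complex 0 →ₗ[R] C) ≃ₗ[R] R :=
  (F.cokerDZeroEquiv.congrLeft C R).trans
    (LinearEquiv.ofBijective (LinearMap.lsmul R C : R →ₗ[R] C →ₗ[R] C) hC.homothety).symm

theorem IsSemidualizing.dual_finite (n : ℕ) : Module.Finite R (cokerD F.complex n →ₗ[R] C) := by
  have := hC.finite
  cases n with
  | zero => exact Module.Finite.equiv (hC.dualCokerDZeroEquiv F).symm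
  | succ n =>
    have := (F.mem n).1
    have := (F.mem n).2
    exact Module.Finite.of_surjective (LinearMap.lcomp R C (cokerDMap F.complex n))
      (hC.exists_extension_self F n)

theorem IsSemidualizing.dual_shortExact (n : ℕ) :
    (mkShort _ _ (dual_exact F n)).ShortExact :=
  mkShort_shortExact _ (LinearMap.lcomp_injective_of_surjective _ (Submodule.mkQ_surjective _))
    (hC.exists_extension_self F n)

/-- Induction along `0 → Ω_n* → F_n* → Ω_{n+1}* → 0`, where `*` is `Hom(-, C)`, starting from `Ω_0*
≅ R`. -/
theorem IsSemidualizing.extVanishes_dual {Y : ModuleCat.{u} R} (hY : PC C Y) (n : ℕ) :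
    ExtVanishes (ModuleCat.of R (cokerD F.complex n →ₗ[R] C)) Y := by
  induction n with
  | zero =>
    have : Projective (ModuleCat.of R R) := ModuleCat.projective_of_categoryTheory_projective _
    exact (ExtVanishes.of_projective (ModuleCat.of R R) Y).of_linearEquiv
      (hC.dualCokerDZeroEquiv F)
  | succ n ih =>
    have := (F.mem n).1
    have := (F.mem n).2
    have := hC.dual_finite F n
    refine ExtVanishes.X₃ (hC.dual_shortExact F n) ih
      (hC.extVanishes_of_PC (PC.hom_of_finiteFree C (F.complex.X n)) hY) fun f => ?_
    -- By biduality a map `Ω_n* → C` is evaluation at an element of `Ω_n`. Evaluation at a preimage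
    -- in `F_n` extends it.
    obtain ⟨g, hg⟩ := exists_extension_of_PC (C := C)
      (A := ModuleCat.of R (cokerD F.complex n →ₗ[R] C))
      (E := ModuleCat.of R (F.complex.X n →ₗ[R] C))
      (LinearMap.lcomp R C (LinearMap.range (F.complex.d (n + 1) n).hom).mkQ) (fun θ => by
        obtain ⟨z, rfl⟩ := (hC.bidual_bijective_cokerD F n).2 θ
        obtain ⟨x, rfl⟩ := Submodule.mkQ_surjective _ z
        exact ⟨LinearMap.applyₗ x, rfl⟩) hY f.hom
    exact ⟨ModuleCat.ofHom g, ModuleCat.hom_ext hg⟩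

end Semidualizing

end

/-! ### `G_C`-projective modules from coresolving classes. -/

noncomputable section
variable {R : Type u} [CommRing R] {C : ModuleCat.{u} R}

/-- The modules with vanishing `Ext` into `C`-projective modules. -/
def extPerp (C : ModuleCat.{u} R) : ObjectProperty (ModuleCat.{u} R) :=
  fun A => ∀ Y : ModuleCat.{u} R, PC C Y → ExtVanishes A Y

/-- A class of modules in `extPerp C` each of which embeds in a `C`-projective module with cokernel
in the class. -/
def IsCoresolving (C : ModuleCat.{u} R) (𝒮 : ObjectProperty (ModuleCat.{u} R)) : Prop :=
  ∀ A, 𝒮 A → extPerp C A ∧ ∃ (U A' : ModuleCat.{u} R) (i : A →ₗ[R] U) (p : U →ₗ[R] A'),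
    PC C U ∧ 𝒮 A' ∧ Function.Injective i ∧ Function.Exact i p ∧ Function.Surjective p

/-- The `B j` are the syzygies of the complete resolution to be built. To the left one takes kernels
of free covers, which stay in `extPerp C`; to the right one iterates the embeddings given by `𝒮`. -/
theorem IsCoresolving.exists_int_family {𝒮 : ObjectProperty (ModuleCat.{u} R)}
    (h : IsCoresolving C 𝒮) {A : ModuleCat.{u} R} (hA : 𝒮 A) :
    ∃ B : ℤ → ModuleCat.{u} R, B 0 = A ∧ (∀ i, extPerp C (B i)) ∧
      ∀ j, ∃ (X : ModuleCat.{u} R) (i : B (j + 1) →ₗ[R] X) (p : X →ₗ[R] B j),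
        (0 ≤ j → Module.Projective R X) ∧ (j < 0 → PC C X) ∧
        Function.Injective i ∧ Function.Exact i p ∧ Function.Surjective p := by
  have hr (B : {B // 𝒮 B}) : ∃ (B' : {B // 𝒮 B}) (U : ModuleCat.{u} R) (i : B.1 →ₗ[R] U)
      (p : U →ₗ[R] B'.1), PC C U ∧ Function.Injective i ∧ Function.Exact i p ∧
        Function.Surjective p := by
    obtain ⟨U, B', i, p, hU, hB', h⟩ := (h B.1 B.2).2
    exact ⟨⟨B', hB'⟩, U, i, p, hU, h⟩
  have hl (B : {B // extPerp C B}) : ∃ (B' : {B // extPerp C B}) (X : ModuleCat.{u} R)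
      (i : B'.1 →ₗ[R] X) (p : X →ₗ[R] B.1), Module.Projective R X ∧ Function.Injective i ∧
        Function.Exact i p ∧ Function.Surjective p := by
    have hS := B.1.shortExact_projectiveShortComplex
    have hP : Module.Projective R B.1.projectiveShortComplex.X₂ := Module.Projective.of_free
    have hP' : Projective B.1.projectiveShortComplex.X₂ :=
      ModuleCat.projective_of_categoryTheory_projective _
    exact ⟨⟨_, fun Y hY => ExtVanishes.X₁ hS (ExtVanishes.of_projective _ Y) (B.2 Y hY)⟩, _, _, _,
      hP, hS.moduleCat_injective_f, exact_of_shortExact hS, hS.moduleCat_surjective_g⟩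
  choose r hr using hr
  choose l hl using hl
  let br : ℕ → {B // 𝒮 B} := fun n => Nat.rec ⟨A, hA⟩ (fun _ => r) n
  let bl : ℕ → {B // extPerp C B} := fun n => Nat.rec ⟨A, (h A hA).1⟩ (fun _ => l) n
  refine ⟨fun j => match j with
    | .ofNat n => (bl n).1
    | .negSucc n => (br (n + 1)).1, rfl, ?_, ?_⟩
  · rintro (n | n)
    · exact (bl n).2
    · exact (h _ (br (n + 1)).2).1
  -- Degree `-1` is where the two halves meet: its source `B 0` belongs to the left half and its
  -- target to the right half, and both halves start at `A`.
  · rintro (n | _ | n)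
    · obtain ⟨X, i, p, hX, h⟩ := hl (bl n)
      exact ⟨X, i, p, fun _ => hX, fun hn => absurd hn (by simp), h⟩
    · obtain ⟨X, i, p, hX, h⟩ := hr (br 0)
      exact ⟨X, i, p, fun hn => absurd hn (by simp), fun _ => hX, h⟩
    · obtain ⟨X, i, p, hX, h⟩ := hr (br (n + 1))
      exact ⟨X, i, p, fun hn => absurd hn (by simp), fun _ => hX, h⟩

/-- Splicing the sequences `0 → B_{j+1} → X_j → B_j → 0` gives the complete resolution, which is
`Hom(-, Y)`-exact because `Ext^1(B_j, Y) = 0`. All later proofs of `G_C`-projectivity reduce to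
exhibiting a coresolving class. -/
theorem IsCoresolving.gpc {𝒮 : ObjectProperty (ModuleCat.{u} R)} (h : IsCoresolving C 𝒮)
    {A : ModuleCat.{u} R} (hA : 𝒮 A) : GPC C A := by
  obtain ⟨B, hB0, hB, hX⟩ := h.exists_int_family hA
  subst hB0
  choose X i p hproj hPC hi hex hp using hX
  have hip (j : ℤ) (x) : p j (i j x) = 0 := (hex j).apply_apply_eq_zero x
  let δ (j : ℤ) : X (j + 1) ⟶ X j := ModuleCat.ofHom (i j ∘ₗ p (j + 1))
  let K : ChainComplex (ModuleCat.{u} R) ℤ := ChainComplex.of X δ (fun j => by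
      ext x
      exact congr(i j $(hip (j + 1) (p (j + 1 + 1) x))).trans (map_zero _))
  have hd (j : ℤ) (x : X (j + 1)) : K.d (j + 1) j x = i j (p (j + 1) x) :=
    congr(($(ChainComplex.of_d X δ j)).hom x)
  have hS (j : ℤ) : (mkShort (i j) (p j) (hex j)).ShortExact :=
    mkShort_shortExact _ (hi j) (hp j)
  refine ⟨K, ⟨(acyclic_int_iff K).2 fun j x hx => ?_, fun Y hY =>
    (linearYonedaObj_acyclic_int_iff K Y).2 fun j f hf => ?_, hproj, hPC⟩, ⟨?_⟩⟩
  · rw [hd] at hx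
    obtain ⟨b, rfl⟩ := (hex (j + 1) x).1 (hi j (hx.trans (map_zero _).symm))
    obtain ⟨y, rfl⟩ := hp (j + 1 + 1) b
    exact ⟨y, hd (j + 1) y⟩
  · obtain ⟨f', hf'⟩ := exists_comp_eq_of_ker_le (hp (j + 1)) f.hom fun x hx => by
      obtain ⟨b, rfl⟩ := (hex (j + 1) x).1 hx
      obtain ⟨y, rfl⟩ := hp (j + 1 + 1) b
      rw [← hd]
      exact congr(($hf).hom y)
    have := hB j Y hY 0
    obtain ⟨g, hg⟩ := exists_extension_of_ext_one (hS j) Y (ModuleCat.ofHom f')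
    refine ⟨g, ?_⟩
    ext x
    exact congr(g $(hd j x)).trans (congr(($hg).hom (p (j + 1) x)).trans (hf' x))
  · have hker : LinearMap.ker (p 0) = LinearMap.range (K.d 1 0).hom := by
      ext x
      rw [LinearMap.mem_ker]
      constructor
      · intro hx
        obtain ⟨b, rfl⟩ := (hex 0 x).1 hx
        obtain ⟨y, rfl⟩ := hp (0 + 1) b
        exact ⟨y, hd 0 y⟩
      · rintro ⟨y, rfl⟩
        exact congr(p 0 $(hd 0 y)).trans (hip 0 _)
    exact ((p 0).quotKerEquivOfSurjective (hp 0)).symm.trans (Submodule.quotEquivOfEq _ _ hker)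

theorem extPerp_of_linearEquiv {A B : ModuleCat.{u} R} (hB : extPerp C B) (e : A ≃ₗ[R] B) :
    extPerp C A :=
  fun Y hY => (hB Y hY).of_linearEquiv e

section

variable (hC : IsSemidualizing C)
include hC

theorem IsSemidualizing.isCoresolving_PC : IsCoresolving C (PC C) := fun A hA =>
  ⟨fun _ hY => hC.extVanishes_of_PC hA hY, A, ModuleCat.of R PUnit, LinearMap.id, 0, hA,
    PC.of_subsingleton C _, Function.injective_id,
    fun x => ⟨fun _ => ⟨x, rfl⟩, fun _ => rfl⟩, Function.surjective_to_subsingleton _⟩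

theorem IsSemidualizing.PC_le_GPC : PC C ≤ GPC C := fun _ hA => hC.isCoresolving_PC.gpc hA

/-- Dualizing a finite free resolution `F` of `C` into `C` gives the coresolution `0 → R → F_0* →
F_1* → ⋯` by `C`-projectives. The coresolving class consists of its cosyzygies. -/
theorem IsSemidualizing.gpc_ring : GPC C (ModuleCat.of R R) := by
  obtain ⟨F⟩ := hC.resolution
  let 𝒮 : ObjectProperty (ModuleCat.{u} R) := fun A =>
    ∃ n, Nonempty (A ≃ₗ[R] (cokerD F.complex n →ₗ[R] C))
  have h : IsCoresolving C 𝒮 := by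
    rintro A ⟨n, ⟨e⟩⟩
    have := (F.mem n).1
    have := (F.mem n).2
    have hS := hC.dual_shortExact F n
    refine ⟨fun Y hY => (hC.extVanishes_dual F hY n).of_linearEquiv e,
      ModuleCat.of R (F.complex.X n →ₗ[R] C), ModuleCat.of R (cokerD F.complex (n + 1) →ₗ[R] C),
      LinearMap.lcomp R C _ ∘ₗ e.toLinearMap, _, PC.hom_of_finiteFree C (F.complex.X n),
      ⟨n + 1, ⟨LinearEquiv.refl _ _⟩⟩, hS.moduleCat_injective_f.comp e.injective, ?_,
      hS.moduleCat_surjective_g⟩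
    intro x
    rw [exact_of_shortExact hS x]
    exact (e.surjective.range_comp _).symm ▸ Iff.rfl
  exact h.gpc ⟨0, ⟨(hC.dualCokerDZeroEquiv F).symm⟩⟩

theorem IsSemidualizing.isCoresolving_GPC : IsCoresolving C (GPC C) := by
  let 𝒮 : ObjectProperty (ModuleCat.{u} R) := fun A =>
    ∃ X : ChainComplex (ModuleCat.{u} R) ℤ, IsCompleteResolution C X ∧
      ∃ j : ℤ, j < 0 ∧ Nonempty (A ≃ₗ[R] cokerD X (j + 1))
  have hperp (X : ChainComplex (ModuleCat.{u} R) ℤ) (hX : IsCompleteResolution C X) (j : ℤ) :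
      extPerp C (cokerD X j) := by
    intro Y hY
    refine RelCoh.extVanishes_cokerD ((acyclic_int_iff X).1 hX.acyclic) (fun i => ?_) (fun i =>
      exists_extension_cokerDMap i
        ((linearYonedaObj_acyclic_int_iff X Y).1 (hX.hom_acyclic Y hY) i)) j
    rcases lt_or_ge i 0 with hi | hi
    · exact hC.extVanishes_of_PC (hX.cProjective i hi) hY
    · have := hX.projective i hi
      have := ModuleCat.projective_of_categoryTheory_projective (X.X i)
      exact ExtVanishes.of_projective _ _
  have h : IsCoresolving C 𝒮 := by
    rintro A ⟨X, hX, j, hj, ⟨e⟩⟩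
    refine ⟨extPerp_of_linearEquiv (hperp X hX _) e, X.X j, cokerD X j,
      cokerDMap X j ∘ₗ e.toLinearMap, Submodule.mkQ _, hX.cProjective j hj, ?_,
      (cokerDMap_injective j ((acyclic_int_iff X).1 hX.acyclic j)).comp e.injective, ?_,
      Submodule.mkQ_surjective _⟩
    · obtain ⟨i, rfl⟩ : ∃ i, j = i + 1 := ⟨j - 1, by simp⟩
      exact ⟨X, hX, i, by lia, ⟨LinearEquiv.refl _ _⟩⟩
    · intro x
      rw [cokerDMap_exact X j x]
      exact (e.surjective.range_comp _).symm ▸ Iff.rfl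
  have hGPC (A : ModuleCat.{u} R) (hA : GPC C A) : 𝒮 A := by
    obtain ⟨X, hX, e⟩ := hA
    have h0 : ∀ i : ℤ, i = 0 → Nonempty (A ≃ₗ[R] cokerD X i) := by
      rintro _ rfl
      exact e
    exact ⟨X, hX, -1, by simp, h0 _ (by simp)⟩
  intro A hA
  obtain ⟨h₁, U, A', i, p, hU, hA', h₂⟩ := h A (hGPC A hA)
  exact ⟨h₁, U, A', i, p, hU, h.gpc hA', h₂⟩

/-- Horseshoe argument: the extensions of `G_C`-projectives form a coresolving class. As `Ext^1(D,
U) = 0`, the embedding `A → U` extends to `B`, giving `B → U × V` whose cokernel is an extension of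
`D'` by `A'`. -/
theorem IsSemidualizing.gpc_of_extension {A B D : ModuleCat.{u} R} (hA : GPC C A) (hD : GPC C D)
    (i : A →ₗ[R] B) (p : B →ₗ[R] D) (hi : Function.Injective i) (hex : Function.Exact i p)
    (hp : Function.Surjective p) : GPC C B := by
  let 𝒮 : ObjectProperty (ModuleCat.{u} R) := fun B => ∃ (A D : ModuleCat.{u} R)
    (i : A →ₗ[R] B) (p : B →ₗ[R] D), GPC C A ∧ GPC C D ∧ Function.Injective i ∧
      Function.Exact i p ∧ Function.Surjective p
  suffices h : IsCoresolving C 𝒮 from h.gpc ⟨A, D, i, p, hA, hD, hi, hex, hp⟩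
  clear hi hex hp p i hA hD
  rintro B ⟨A, D, i, p, hA, hD, hi, hex, hp⟩
  obtain ⟨hA, U, A', v, q, hU, hA', hv, hvq, hq⟩ := hC.isCoresolving_GPC A hA
  obtain ⟨hD, V, D', w, r, hV, hD', hw, hwr, hr⟩ := hC.isCoresolving_GPC D hD
  have hS := mkShort_shortExact hex hi hp
  have hpi (a) : p (i a) = 0 := hex.apply_apply_eq_zero a
  refine ⟨fun Y hY => ExtVanishes.X₂ hS (hA Y hY) (hD Y hY), ?_⟩
  have := hD U hU 0
  obtain ⟨g, hg⟩ := exists_extension_of_ext_one hS U (ModuleCat.ofHom v)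
  replace hg (a : A) : g (i a) = v a := congr(($hg).hom a)
  let j : B →ₗ[R] U × V := g.hom.prod (w ∘ₗ p)
  have hj (b : B) : j b = (g b, w (p b)) := rfl
  have hmk (x : U × V) : (LinearMap.range j).mkQ x = 0 ↔ ∃ b, (g b, w (p b)) = x :=
    Submodule.Quotient.mk_eq_zero _
  obtain ⟨α, hα⟩ := exists_comp_eq_of_ker_le hq ((LinearMap.range j).mkQ ∘ₗ LinearMap.inl R U V)
    fun x hx => by
      obtain ⟨a, rfl⟩ := (hvq x).1 hx
      exact (hmk _).2 ⟨i a, by rw [hg, hpi, map_zero, LinearMap.inl_apply]⟩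
  obtain ⟨β, hβ⟩ := exists_comp_eq_of_ker_le (Submodule.mkQ_surjective (LinearMap.range j))
    (r ∘ₗ LinearMap.snd R U V) fun x hx => by
      obtain ⟨b, rfl⟩ := (hmk x).1 hx
      exact hwr.apply_apply_eq_zero _
  replace hα (x : U) : α (q x) = (LinearMap.range j).mkQ (x, 0) := hα x
  replace hβ (x : U × V) : β ((LinearMap.range j).mkQ x) = r x.2 := hβ x
  refine ⟨ModuleCat.of R (U × V), ModuleCat.of R ((U × V) ⧸ LinearMap.range j), j,
    (LinearMap.range j).mkQ, hU.prod hV, ⟨A', D', α, β, hA', hD', ?_, ?_, ?_⟩, ?_,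
    LinearMap.exact_map_mkQ_range j, Submodule.mkQ_surjective _⟩
  · rw [← LinearMap.ker_eq_bot, LinearMap.ker_eq_bot']
    intro x hx
    obtain ⟨x, rfl⟩ := hq x
    rw [hα, hmk] at hx
    obtain ⟨b, hb⟩ := hx
    rw [Prod.mk.injEq] at hb
    obtain ⟨a, rfl⟩ := (hex b).1 (hw (hb.2.trans (map_zero _).symm))
    rw [← hb.1, hg]
    exact hvq.apply_apply_eq_zero a
  · intro x
    constructor
    · intro hx
      obtain ⟨⟨x, y⟩, rfl⟩ := Submodule.mkQ_surjective _ x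
      rw [hβ] at hx
      obtain ⟨d, rfl⟩ := (hwr y).1 hx
      obtain ⟨b, rfl⟩ := hp d
      refine ⟨q (x - g b), ?_⟩
      rw [hα, ← sub_eq_zero, ← map_sub, hmk]
      exact ⟨-b, by simp⟩
    · rintro ⟨x, rfl⟩
      obtain ⟨x, rfl⟩ := hq x
      rw [hα, hβ, map_zero]
  · intro d
    obtain ⟨y, rfl⟩ := hr d
    exact ⟨(LinearMap.range j).mkQ (0, y), hβ _⟩
  · rw [← LinearMap.ker_eq_bot, LinearMap.ker_eq_bot']
    intro b hb
    rw [hj, Prod.mk_eq_zero] at hb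
    obtain ⟨a, rfl⟩ := (hex b).1 (hw (hb.2.trans (map_zero _).symm))
    have ha := hb.1
    rw [hg] at ha
    rw [hv (ha.trans (map_zero _).symm), map_zero]

theorem IsSemidualizing.extPerp_of_gpc {A : ModuleCat.{u} R} (hA : GPC C A) : extPerp C A :=
  (hC.isCoresolving_GPC A hA).1

end

end

/-! ### Modules of finite relative dimension and their proper resolutions. -/

noncomputable section
variable {R : Type u} [CommRing R] {C : ModuleCat.{u} R}

namespace Resolution

variable {𝒳 : ObjectProperty (ModuleCat.{u} R)}

/-- The resolution of a zero module by zero modules. -/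
def zero (M : ModuleCat.{u} R) [Subsingleton M] (h : 𝒳 (ModuleCat.of R PUnit)) :
    Resolution 𝒳 M where
  complex := { X := fun _ => ModuleCat.of R PUnit, d := 0 }
  mem _ := h
  π := 0
  d_comp_π := Limits.comp_zero
  acyclic := (acyclic_augment_iff _ _ _).2 ⟨Function.surjective_to_subsingleton _,
    fun _ _ => ⟨0, rfl⟩, fun _ _ _ => ⟨0, rfl⟩⟩

theorem zero_homFrom_acyclic (M : ModuleCat.{u} R) [Subsingleton M] (h : 𝒳 (ModuleCat.of R PUnit))
    (A : ModuleCat.{u} R) : (homFrom A (zero M h).augmented).Acyclic := by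
  have hz {D : ModuleCat.{u} R} [Subsingleton D] (f g : A ⟶ D) : f = g :=
    (ModuleCat.isZero_of_subsingleton D).eq_of_tgt _ _
  exact (homFrom_augment_acyclic_iff _ _ _ _).2
    ⟨fun f => ⟨0, hz _ _⟩, fun f _ => ⟨0, hz (D := ModuleCat.of R PUnit) _ _⟩,
      fun n f _ => ⟨0, hz (D := ModuleCat.of R PUnit) _ _⟩⟩

/-- The resolution of `M` obtained by splicing a resolution of `K` with a short exact sequence
`0 → K → G → M → 0`. -/
def splice {K G M : ModuleCat.{u} R} (Y : Resolution 𝒳 K) (hG : 𝒳 G) (i : K →ₗ[R] G)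
    (p : G →ₗ[R] M) (hi : Function.Injective i) (hex : Function.Exact i p)
    (hp : Function.Surjective p) : Resolution 𝒳 M where
  complex := Y.complex.augment (Y.π ≫ ModuleCat.ofHom i)
    (by rw [← Category.assoc, Y.d_comp_π, Limits.zero_comp])
  mem
    | 0 => hG
    | n + 1 => Y.mem n
  π := ModuleCat.ofHom p
  d_comp_π := by
    ext x
    exact hex.apply_apply_eq_zero _
  acyclic := by
    refine (acyclic_augment_iff _ _ _).2 ⟨hp, fun x hx => ?_, ?_⟩
    · obtain ⟨k, rfl⟩ := (hex x).1 hx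
      obtain ⟨y, rfl⟩ := Y.surjective_π k
      exact ⟨y, rfl⟩
    · rintro (_ | n) x hx
      · exact Y.exists_of_π_eq_zero x (hi (Eq.trans hx (map_zero i).symm))
      · exact Y.exists_of_d_eq_zero n x hx

theorem splice_homFrom_acyclic {K G M : ModuleCat.{u} R} (Y : Resolution 𝒳 K) (hG : 𝒳 G)
    (i : K →ₗ[R] G) (p : G →ₗ[R] M) (hi : Function.Injective i) (hex : Function.Exact i p)
    (hp : Function.Surjective p) (A : ModuleCat.{u} R) (hY : (homFrom A Y.augmented).Acyclic)
    [Subsingleton (Abelian.Ext A K 1)] :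
    (homFrom A (Y.splice hG i p hi hex hp).augmented).Acyclic := by
  have hS := mkShort_shortExact hex hi hp
  obtain ⟨h₁, h₂, h₃⟩ := (homFrom_augment_acyclic_iff _ _ _ _).1 hY
  have := hS.mono_f
  refine (homFrom_augment_acyclic_iff _ _ _ _).2 ⟨exists_lift_of_ext_one hS A, fun f hf => ?_, ?_⟩
  · obtain ⟨g, hg⟩ := h₁ (hS.exact.lift f hf)
    refine ⟨g, ?_⟩
    exact (Category.assoc _ _ _).symm.trans (congr($hg ≫ _).trans (hS.exact.lift_f f hf))
  · rintro (_ | n) f hf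
    · refine h₂ f ((cancel_mono (ModuleCat.ofHom i)).1 ?_)
      exact (Category.assoc _ _ _).trans (Eq.trans hf Limits.zero_comp.symm)
    · exact h₃ n f hf

/-- A resolution by modules in a smaller class. -/
def ofLE {𝒴 : ObjectProperty (ModuleCat.{u} R)} {M : ModuleCat.{u} R} (X : Resolution 𝒳 M)
    (h : 𝒳 ≤ 𝒴) : Resolution 𝒴 M where
  complex := X.complex
  mem n := h _ (X.mem n)
  π := X.π
  d_comp_π := X.d_comp_π
  acyclic := X.acyclic

end Resolution

/-- `M` is obtained by splicing `n` short exact sequences `0 → K → G → M → 0` with `G` in `𝒳`, the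
last kernel being in `𝒳`; that is, it has a resolution of length at most `n` by modules in `𝒳`. -/
def DimLE (𝒳 : ObjectProperty (ModuleCat.{u} R)) : ℕ → ModuleCat.{u} R → Prop
  | 0, M => 𝒳 M
  | n + 1, M => ∃ (K G : ModuleCat.{u} R) (i : K →ₗ[R] G) (p : G →ₗ[R] M), 𝒳 G ∧ DimLE 𝒳 n K ∧
      Function.Injective i ∧ Function.Exact i p ∧ Function.Surjective p

theorem exact_zero_id (M : ModuleCat.{u} R) :
    Function.Exact (0 : ModuleCat.of R PUnit.{u+1} →ₗ[R] M) (LinearMap.id : M →ₗ[R] M) := fun x =>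
  ⟨fun hx => ⟨0, hx.symm⟩, by rintro ⟨y, rfl⟩; rfl⟩

/-- The test class `𝒵` is independent of `𝒳`, since `PC`-resolutions must later be tested against
all of `GPC`. -/
theorem DimLE.exists_resolution {𝒳 𝒵 : ObjectProperty (ModuleCat.{u} R)}
    (h0 : 𝒳 (ModuleCat.of R PUnit))
    (hext : ∀ n M, DimLE 𝒳 n M → ∀ A, 𝒵 A → Subsingleton (Abelian.Ext A M 1)) (n : ℕ)
    {M : ModuleCat.{u} R} (hM : DimLE 𝒳 n M) :
    ∃ X : Resolution 𝒳 M, (∀ m, n < m → Subsingleton (X.complex.X m)) ∧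
      ∀ A, 𝒵 A → (homFrom A X.augmented).Acyclic := by
  induction n generalizing M with
  | zero =>
    let Y : Resolution 𝒳 (ModuleCat.of R PUnit.{u+1}) := Resolution.zero _ h0
    refine ⟨Y.splice hM 0 LinearMap.id (Function.injective_of_subsingleton _) (exact_zero_id M)
      Function.surjective_id, ?_, fun A hA => ?_⟩
    · rintro (_ | m) hm
      · simp at hm
      · exact inferInstanceAs (Subsingleton PUnit)
    · have := hext 0 _ h0 A hA
      exact Y.splice_homFrom_acyclic _ _ _ _ _ _ A (Resolution.zero_homFrom_acyclic _ h0 A)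
  | succ n ih =>
    obtain ⟨K, G, i, p, hG, hK, hi, hex, hp⟩ := hM
    obtain ⟨Y, hY, hY'⟩ := ih hK
    refine ⟨Y.splice hG i p hi hex hp, ?_, fun A hA => ?_⟩
    · rintro (_ | m) hm
      · simp at hm
      · exact hY m (by simpa using hm)
    · have := hext n K hK A hA
      exact Y.splice_homFrom_acyclic hG i p hi hex hp A (hY' A hA)

theorem DimLE.of_linearEquiv {𝒳 : ObjectProperty (ModuleCat.{u} R)}
    (h𝒳 : ∀ {A B : ModuleCat.{u} R}, (A ≃ₗ[R] B) → 𝒳 A → 𝒳 B) {n : ℕ} {M N : ModuleCat.{u} R}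
    (e : M ≃ₗ[R] N) (hM : DimLE 𝒳 n M) : DimLE 𝒳 n N := by
  cases n with
  | zero => exact h𝒳 e hM
  | succ n =>
    obtain ⟨K, G, i, p, hG, hK, hi, hex, hp⟩ := hM
    refine ⟨K, G, i, e.toLinearMap ∘ₗ p, hG, hK, hi, fun x => ?_, e.surjective.comp hp⟩
    rw [← hex x]
    exact e.map_eq_zero_iff

theorem Resolution.dimLE {𝒳 : ObjectProperty (ModuleCat.{u} R)}
    (h𝒳 : ∀ {A B : ModuleCat.{u} R}, (A ≃ₗ[R] B) → 𝒳 A → 𝒳 B) {M : ModuleCat.{u} R}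
    (X : Resolution 𝒳 M) (n : ℕ) (h : 𝒳 (cokerD X.complex n)) : DimLE 𝒳 n M := by
  have key (k : ℕ) : ∀ j, j + k = n → DimLE 𝒳 k (cokerD X.complex j) := by
    induction k with
    | zero =>
      rintro j rfl
      exact h
    | succ k ih =>
      intro j hj
      exact ⟨cokerD X.complex (j + 1), X.complex.X j, _, _, X.mem j, ih (j + 1) (by lia),
        cokerDMap_injective j (X.exists_of_d_eq_zero j), cokerDMap_exact X.complex j,
        Submodule.mkQ_surjective _⟩
  exact (key n 0 (zero_add n)).of_linearEquiv h𝒳 X.cokerDZeroEquiv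

/-- The cokernel of a differential with zero source. -/
def cokerDEquivOfSubsingleton (K : ChainComplex (ModuleCat.{u} R) ℕ) (n : ℕ)
    [Subsingleton (K.X (n + 1))] : K.X n ≃ₗ[R] cokerD K n :=
  (Submodule.quotEquivOfEqBot _ (by
    rw [LinearMap.range_eq_bot]
    ext x
    rw [Subsingleton.elim x 0, map_zero, map_zero])).symm

theorem GPC.of_linearEquiv {A B : ModuleCat.{u} R} (e : A ≃ₗ[R] B) (hA : GPC C A) : GPC C B := by
  obtain ⟨X, hX, ⟨e'⟩⟩ := hA
  exact ⟨X, hX, ⟨e.symm.trans e'⟩⟩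

section

variable (hC : IsSemidualizing C)
include hC

theorem IsSemidualizing.extVanishes_of_dimLE {G : ModuleCat.{u} R} (hG : GPC C G) (n : ℕ)
    {M : ModuleCat.{u} R} (hM : DimLE (PC C) n M) : ExtVanishes G M := by
  induction n generalizing M with
  | zero => exact hC.extPerp_of_gpc hG M hM
  | succ n ih =>
    obtain ⟨K, U, i, p, hU, hK, hi, hex, hp⟩ := hM
    exact ExtVanishes.covariant_X₃ (mkShort_shortExact hex hi hp) (ih hK)
      (hC.extPerp_of_gpc hG U hU)

/-- `G` is the pushout of `a` and `k`. Its column `0 → G₀ → G → G' → 0` makes it `G_C`-projective,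
and its row `0 → K → G → M → 0` presents `M` with the better kernel `K`. -/
theorem IsSemidualizing.exists_gpc_pushout {M' K G₀ M G' : ModuleCat.{u} R} (a : M' →ₗ[R] G₀)
    (b : G₀ →ₗ[R] M) (ha : Function.Injective a) (hab : Function.Exact a b)
    (hb : Function.Surjective b) (k : M' →ₗ[R] K) (q : K →ₗ[R] G') (hk : Function.Injective k)
    (hkq : Function.Exact k q) (hq : Function.Surjective q) (hG₀ : GPC C G₀) (hG' : GPC C G') :
    ∃ (G : ModuleCat.{u} R) (i : K →ₗ[R] G) (p : G →ₗ[R] M) (v : G₀ →ₗ[R] G), GPC C G ∧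
      Function.Injective i ∧ Function.Exact i p ∧ Function.Surjective p ∧
      (∀ x, p (v x) = b x) ∧ (∀ m, i (k m) = v (a m)) := by
  let j : M' →ₗ[R] K × G₀ := k.prod (-a)
  have hmk (x : K × G₀) : (LinearMap.range j).mkQ x = 0 ↔ ∃ m, (k m, -a m) = x :=
    Submodule.Quotient.mk_eq_zero _
  obtain ⟨p, hp⟩ := exists_comp_eq_of_ker_le (Submodule.mkQ_surjective (LinearMap.range j))
    (b ∘ₗ LinearMap.snd R K G₀) fun x hx => by
      obtain ⟨m, rfl⟩ := (hmk x).1 hx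
      simp [hab.apply_apply_eq_zero m]
  obtain ⟨r, hr⟩ := exists_comp_eq_of_ker_le (Submodule.mkQ_surjective (LinearMap.range j))
    (q ∘ₗ LinearMap.fst R K G₀) fun x hx => by
      obtain ⟨m, rfl⟩ := (hmk x).1 hx
      simp [hkq.apply_apply_eq_zero m]
  replace hp (x : K × G₀) : p ((LinearMap.range j).mkQ x) = b x.2 := hp x
  replace hr (x : K × G₀) : r ((LinearMap.range j).mkQ x) = q x.1 := hr x
  refine ⟨ModuleCat.of R ((K × G₀) ⧸ LinearMap.range j),
    (LinearMap.range j).mkQ ∘ₗ LinearMap.inl R K G₀, p,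
    (LinearMap.range j).mkQ ∘ₗ LinearMap.inr R K G₀, ?_, ?_, fun x => ⟨fun hx => ?_, ?_⟩,
    fun y => ?_, fun x => hp _, fun m => ?_⟩
  · refine hC.gpc_of_extension hG₀ hG' ((LinearMap.range j).mkQ ∘ₗ LinearMap.inr R K G₀) r
      ?_ (fun x => ⟨fun hx => ?_, ?_⟩) fun y => ?_
    · rw [← LinearMap.ker_eq_bot, LinearMap.ker_eq_bot']
      intro x hx
      obtain ⟨m, hm⟩ := (hmk _).1 hx
      have h₁ : k m = 0 := congr(($hm).1)
      have h₂ : -a m = x := congr(($hm).2)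
      rw [← h₂, hk (h₁.trans (map_zero k).symm), map_zero, neg_zero]
    · obtain ⟨⟨x, y⟩, rfl⟩ := Submodule.mkQ_surjective _ x
      rw [hr] at hx
      obtain ⟨m, rfl⟩ := (hkq x).1 hx
      refine ⟨y + a m, ?_⟩
      rw [LinearMap.comp_apply, ← sub_eq_zero, ← map_sub, hmk]
      exact ⟨-m, by simp⟩
    · rintro ⟨x, rfl⟩
      exact (hr _).trans (map_zero _)
    · obtain ⟨x, rfl⟩ := hq y
      exact ⟨(LinearMap.range j).mkQ (x, 0), hr _⟩
  · rw [← LinearMap.ker_eq_bot, LinearMap.ker_eq_bot']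
    intro x hx
    obtain ⟨m, hm⟩ := (hmk _).1 hx
    have h₁ : k m = x := congr(($hm).1)
    have h₂ : -a m = 0 := congr(($hm).2)
    rw [← h₁, ha ((neg_eq_zero.1 h₂).trans (map_zero a).symm), map_zero]
  · obtain ⟨⟨x, y⟩, rfl⟩ := Submodule.mkQ_surjective _ x
    rw [hp] at hx
    obtain ⟨m, rfl⟩ := (hab y).1 hx
    refine ⟨x + k m, ?_⟩
    rw [LinearMap.comp_apply, ← sub_eq_zero, ← map_sub, hmk]
    exact ⟨m, by simp⟩
  · rintro ⟨x, rfl⟩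
    exact (hp _).trans (map_zero _)
  · obtain ⟨x, rfl⟩ := hb y
    exact ⟨(LinearMap.range j).mkQ (0, x), hp _⟩
  · rw [LinearMap.comp_apply, LinearMap.comp_apply, ← sub_eq_zero, ← map_sub, hmk]
    exact ⟨m, by simp⟩

/-- Replacing the kernel by its hull `K'` gives `M ≅ G / K'` with `G` `G_C`-projective. Embed `G` in
a `C`-projective `U` with `G_C`-projective cokernel; then `U / K'` is a hull of `M`, and `(U / K') /
M ≅ U / G`. -/
theorem IsSemidualizing.exists_hull (n : ℕ) {M : ModuleCat.{u} R} (hM : DimLE (GPC C) n M) :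
    ∃ (K G : ModuleCat.{u} R) (i : M →ₗ[R] K) (p : K →ₗ[R] G), DimLE (PC C) n K ∧ GPC C G ∧
      Function.Injective i ∧ Function.Exact i p ∧ Function.Surjective p := by
  induction n generalizing M with
  | zero => exact (hC.isCoresolving_GPC M hM).2
  | succ n ih =>
    obtain ⟨M', G₀, a, b, hG₀, hM', ha, hab, hb⟩ := hM
    obtain ⟨K', G', k, q, hK', hG', hk, hkq, hq⟩ := ih hM'
    obtain ⟨G, f, g, -, hG, hf, hfg, hg, -⟩ :=
      hC.exists_gpc_pushout a b ha hab hb k q hk hkq hq hG₀ hG'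
    obtain ⟨-, U, G'', v, r, hU, hG'', hv, hvr, hr⟩ := hC.isCoresolving_GPC G hG
    have hmk (x : U) : (LinearMap.range (v ∘ₗ f)).mkQ x = 0 ↔ ∃ y, v (f y) = x :=
      Submodule.Quotient.mk_eq_zero _
    obtain ⟨α, hα⟩ := exists_comp_eq_of_ker_le hg ((LinearMap.range (v ∘ₗ f)).mkQ ∘ₗ v)
      fun x hx => by
        obtain ⟨y, rfl⟩ := (hfg x).1 hx
        exact (hmk _).2 ⟨y, rfl⟩
    obtain ⟨β, hβ⟩ := exists_comp_eq_of_ker_le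
      (Submodule.mkQ_surjective (LinearMap.range (v ∘ₗ f))) r fun x hx => by
        obtain ⟨y, rfl⟩ := (hmk x).1 hx
        exact hvr.apply_apply_eq_zero _
    refine ⟨ModuleCat.of R (U ⧸ LinearMap.range (v ∘ₗ f)), G'', α, β,
      ⟨K', U, v ∘ₗ f, (LinearMap.range (v ∘ₗ f)).mkQ, hU, hK', hv.comp hf,
        LinearMap.exact_map_mkQ_range _, Submodule.mkQ_surjective _⟩, hG'', ?_,
      fun x => ⟨fun hx => ?_, ?_⟩, fun y => ?_⟩
    · rw [← LinearMap.ker_eq_bot, LinearMap.ker_eq_bot']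
      intro x hx
      obtain ⟨x, rfl⟩ := hg x
      rw [hα] at hx
      obtain ⟨y, hy⟩ := (hmk _).1 hx
      rw [← hv hy]
      exact hfg.apply_apply_eq_zero y
    · obtain ⟨x, rfl⟩ := Submodule.mkQ_surjective _ x
      rw [hβ] at hx
      obtain ⟨y, rfl⟩ := (hvr x).1 hx
      exact ⟨g y, hα y⟩
    · rintro ⟨x, rfl⟩
      obtain ⟨x, rfl⟩ := hg x
      rw [hα]
      exact (hβ _).trans (hvr.apply_apply_eq_zero x)
    · obtain ⟨x, rfl⟩ := hr y
      exact ⟨_, hβ x⟩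

/-- The kernel of a `GPC`-cover is replaced by its hull, to which no `G_C`-projective has a nonzero
`Ext^1`. Properness follows, and the length does not increase. -/
theorem IsSemidualizing.exists_proper_resolution (n : ℕ) {M : ModuleCat.{u} R}
    (hM : DimLE (GPC C) n M) : ∃ X : Resolution (GPC C) M, X.IsProper ∧
      ∀ m, n < m → Subsingleton (X.complex.X m) := by
  have hext (n M) (hM : DimLE (PC C) n M) (A) (hA : GPC C A) : Subsingleton (Abelian.Ext A M 1) :=
    hC.extVanishes_of_dimLE hA n hM 0
  have h0 := PC.of_subsingleton C (ModuleCat.of R PUnit)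
  obtain ⟨K, G, i, p, hG, Y, hi, hex, hp, hK, hY, hY'⟩ : ∃ (K G : ModuleCat.{u} R)
      (i : K →ₗ[R] G) (p : G →ₗ[R] M) (_ : GPC C G) (Y : Resolution (PC C) K),
      Function.Injective i ∧ Function.Exact i p ∧ Function.Surjective p ∧
      (∃ m, DimLE (PC C) m K) ∧ (∀ m, n ≤ m → Subsingleton (Y.complex.X m)) ∧
      ∀ A, GPC C A → (homFrom A Y.augmented).Acyclic := by
    cases n with
    | zero =>
      exact ⟨ModuleCat.of R PUnit, M, 0, LinearMap.id, hM, Resolution.zero _ h0,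
        Function.injective_of_subsingleton _, exact_zero_id M, Function.surjective_id, ⟨0, h0⟩,
        fun m _ => inferInstanceAs (Subsingleton PUnit),
        fun A _ => Resolution.zero_homFrom_acyclic _ h0 A⟩
    | succ n =>
      obtain ⟨M', G₀, a, b, hG₀, hM', ha, hab, hb⟩ := hM
      obtain ⟨K', G', k, q, hK', hG', hk, hkq, hq⟩ := hC.exists_hull n hM'
      obtain ⟨G, f, g, -, hG, hf, hfg, hg, -⟩ :=
        hC.exists_gpc_pushout a b ha hab hb k q hk hkq hq hG₀ hG'
      obtain ⟨Y, hY, hY'⟩ := DimLE.exists_resolution h0 hext n hK'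
      exact ⟨K', G, f, g, hG, Y, hf, hfg, hg, ⟨n, hK'⟩, fun m hm => hY m hm, hY'⟩
  refine ⟨(Y.ofLE hC.PC_le_GPC).splice hG i p hi hex hp, fun A hA => ?_, ?_⟩
  · obtain ⟨m, hK⟩ := hK
    have := hext m K hK A hA
    exact Resolution.splice_homFrom_acyclic _ hG i p hi hex hp A (hY' A hA)
  · rintro (_ | m) hm
    · simp at hm
    · exact hY m (by lia)

end
end

/-! ### Cohomology classes and injectivity of the comparison map. -/

noncomputable section
variable {R : Type u} [CommRing R] {C : ModuleCat.{u} R}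

section Homology

variable (K L : CochainComplex (ModuleCat.{u} R) ℕ) (n : ℕ)

/-- `h` is the cohomology class of the cocycle `x`. -/
def IsClass (x : K.X n) (h : K.homology n) : Prop :=
  ∃ z : K.cycles n, K.iCycles n z = x ∧ K.homologyπ n z = h

variable {K L n}

theorem exists_isClass (h : K.homology n) : ∃ x, K.d n (n + 1) x = 0 ∧ IsClass K n x h := by
  obtain ⟨z, rfl⟩ := (ModuleCat.epi_iff_surjective (K.homologyπ n)).1 inferInstance h
  exact ⟨_, congr(($(K.iCycles_d n (n + 1))).hom z), z, rfl, rfl⟩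

theorem exists_isClass_of_d_eq_zero (x : K.X n) (hx : K.d n (n + 1) x = 0) :
    ∃ h, IsClass K n x h := by
  have hex : (ShortComplex.mk (K.iCycles n) (K.d n (n + 1)) (K.iCycles_d n (n + 1))).Exact :=
    ShortComplex.exact_of_f_is_kernel _ (K.cyclesIsKernel n (n + 1) (by simp))
  obtain ⟨z, hz⟩ := (ShortComplex.moduleCat_exact_iff _).1 hex x hx
  exact ⟨_, z, hz, rfl⟩

theorem IsClass.smul {x : K.X n} {h : K.homology n} (hx : IsClass K n x h) (r : R) :
    IsClass K n (r • x) (r • h) := by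
  obtain ⟨z, rfl, rfl⟩ := hx
  exact ⟨r • z, map_smul _ _ _, map_smul _ _ _⟩

theorem IsClass.sub {x y : K.X n} {h h' : K.homology n} (hx : IsClass K n x h)
    (hy : IsClass K n y h') : IsClass K n (x - y) (h - h') := by
  obtain ⟨z, rfl, rfl⟩ := hx
  obtain ⟨w, rfl, rfl⟩ := hy
  exact ⟨z - w, map_sub _ _ _, map_sub _ _ _⟩

theorem IsClass.map {x : K.X n} {h : K.homology n} (hx : IsClass K n x h) (φ : K ⟶ L) :
    IsClass L n (φ.f n x) (HomologicalComplex.homologyMap φ n h) := by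
  obtain ⟨z, rfl, rfl⟩ := hx
  exact ⟨HomologicalComplex.cyclesMap φ n z,
    congr(($(HomologicalComplex.cyclesMap_i φ n)).hom z),
    congr(($(HomologicalComplex.homologyπ_naturality φ n)).hom z).symm⟩

theorem IsClass.eq_zero_iff {x : K.X (n + 1)} {h : K.homology (n + 1)}
    (hx : IsClass K (n + 1) x h) : h = 0 ↔ ∃ y, K.d n (n + 1) y = x := by
  obtain ⟨z, rfl, rfl⟩ := hx
  have hex : (ShortComplex.mk (K.toCycles n (n + 1)) (K.homologyπ (n + 1))
      (K.toCycles_comp_homologyπ n (n + 1))).Exact :=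
    ShortComplex.exact_of_g_is_cokernel _ (K.homologyIsCokernel n (n + 1) (by simp))
  have hi := (ModuleCat.mono_iff_injective (K.iCycles (n + 1))).1 inferInstance
  have ht (y) : K.iCycles (n + 1) (K.toCycles n (n + 1) y) = K.d n (n + 1) y :=
    congr(($(K.toCycles_i n (n + 1))).hom y)
  constructor
  · intro h
    obtain ⟨y, hy⟩ := (ShortComplex.moduleCat_exact_iff _).1 hex z h
    exact ⟨y, (ht y).symm.trans congr(K.iCycles (n + 1) $hy)⟩
  · rintro ⟨y, hy⟩
    rw [← hi ((ht y).trans hy)]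
    exact congr(($(K.toCycles_comp_homologyπ n (n + 1))).hom y)

theorem IsClass.eq_iff {x y : K.X (n + 1)} {h h' : K.homology (n + 1)}
    (hx : IsClass K (n + 1) x h) (hy : IsClass K (n + 1) y h') :
    h = h' ↔ ∃ w, K.d n (n + 1) w = x - y := by
  rw [← sub_eq_zero, (hx.sub hy).eq_zero_iff]

end Homology

namespace Resolution

variable {𝒳 : ObjectProperty (ModuleCat.{u} R)} {M : ModuleCat.{u} R} (X : Resolution 𝒳 M)
  {P : ProjectiveResolution M} (φ : X.Lift P)

theorem surjective_projectiveResolution_π (P : ProjectiveResolution M) :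
    ∀ m : M, ∃ p : P.complex.X 0, P.π.f 0 p = m :=
  (ModuleCat.epi_iff_surjective (P.π.f 0)).1 inferInstance

theorem exact_projectiveResolution (P : ProjectiveResolution M) (p : P.complex.X 0)
    (hp : P.π.f 0 p = 0) : ∃ q, P.complex.d 1 0 q = p := by
  have hex := ShortComplex.exact_of_g_is_cokernel
    (ShortComplex.mk _ _ P.complex_d_comp_π_f_zero) P.isColimitCokernelCofork
  exact (ShortComplex.moduleCat_exact_iff _).1 hex p hp

theorem surjective_coprod_lift (y : X.complex.X 0) :
    ∃ b p, X.complex.d 1 0 b + φ.hom.f 0 p = y := by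
  obtain ⟨p, hp⟩ := surjective_projectiveResolution_π P (X.π y)
  obtain ⟨b, hb⟩ := X.exists_of_π_eq_zero (y - φ.hom.f 0 p) (by
    rw [map_sub, sub_eq_zero, ← hp]
    exact congr(($(φ.comm)).hom p).symm)
  exact ⟨b, p, by rw [hb, sub_add_cancel]⟩

/-- The cone of `φ` is exact, so `X_0` is the quotient of `X_1 ⊕ P_0` by elements `(b, d q)` with `b
+ φ_1 q` a boundary; the pair `(f, g)` vanishes on these. For injectivity in degree `1`, `g` bounds
the pullback of the cocycle `f`, and `u` then bounds `f`. -/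
theorem exists_glue {N : ModuleCat.{u} R} (f : X.complex.X 1 ⟶ N) (g : P.complex.X 0 ⟶ N)
    (hf : X.complex.d 2 1 ≫ f = 0) (hg : P.complex.d 1 0 ≫ g = φ.hom.f 1 ≫ f) :
    ∃ u : X.complex.X 0 ⟶ N, X.complex.d 1 0 ≫ u = f ∧ φ.hom.f 0 ≫ u = g := by
  have hd (b) : X.π (X.complex.d 1 0 b) = 0 := congr(($(X.d_comp_π)).hom b)
  have hπ (p) : X.π (φ.hom.f 0 p) = P.π.f 0 p := congr(($(φ.comm)).hom p)
  have hφ (q) : X.complex.d 1 0 (φ.hom.f 1 q) = φ.hom.f 0 (P.complex.d 1 0 q) :=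
    congr(($(φ.hom.comm 1 0)).hom q)
  obtain ⟨u, hu⟩ := exists_comp_eq_of_ker_le
    (p := (X.complex.d 1 0).hom.coprod (φ.hom.f 0).hom)
    (fun y => by
      obtain ⟨b, p, rfl⟩ := X.surjective_coprod_lift φ y
      exact ⟨(b, p), by simp⟩) (f.hom.coprod g.hom) (by
    rintro ⟨b, p⟩ hbp
    rw [LinearMap.coprod_apply] at hbp ⊢
    replace hbp : X.complex.d 1 0 b + φ.hom.f 0 p = 0 := hbp
    have hp : P.π.f 0 p = 0 := by
      have := congr(X.π $hbp)
      rwa [map_add, hd, zero_add, hπ, map_zero] at this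
    obtain ⟨q, rfl⟩ := exact_projectiveResolution P p hp
    have hb : X.complex.d 1 0 (b + φ.hom.f 1 q) = 0 := by rw [map_add, hφ, hbp]
    obtain ⟨w, hw⟩ := X.exists_of_d_eq_zero 0 (b + φ.hom.f 1 q) hb
    have h₁ : g (P.complex.d 1 0 q) = f (φ.hom.f 1 q) := congr(($hg).hom q)
    have h₂ : f (X.complex.d 2 1 w) = 0 := congr(($hf).hom w)
    change f b + g (P.complex.d 1 0 q) = 0
    rw [h₁, ← map_add]
    exact congr(f $hw).symm.trans h₂)
  refine ⟨ModuleCat.ofHom u, ?_, ?_⟩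
  · ext b
    simpa using hu (b, 0)
  · ext p
    simpa using hu (0, p)

theorem injective_comparison (N : ModuleCat.{u} R) :
    Function.Injective (X.comparison φ N 1) := by
  suffices h : Function.Injective (HomologicalComplex.homologyMap (homMap φ.hom N) 1) from
    (P.isoExt 1 N).symm.toLinearEquiv.injective.comp h
  refine (injective_iff_map_eq_zero _).2 fun h hh => ?_
  obtain ⟨f, hf, hfh⟩ := exists_isClass h
  obtain ⟨g, hg⟩ := ((hfh.map (homMap φ.hom N)).eq_zero_iff).1 hh
  obtain ⟨u, hu, -⟩ := X.exists_glue φ f g hf hg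
  exact (hfh.eq_zero_iff).2 ⟨u, hu⟩

end Resolution

end

/-! ### Nonvanishing of `Ext(C, k)`, and infinite `PC`-dimension. -/

noncomputable section
variable {R : Type u} [CommRing R] {C : ModuleCat.{u} R}

section

variable [IsLocalRing R]

open IsLocalRing TensorProduct

/-- Maps `A → k` are the functionals on the vector space `k ⊗ A`. If all of them extend to `E`, an
element dying in `k ⊗ E` is killed by every functional. -/
theorem lTensor_residueField_injective {A E : Type u} [AddCommGroup A] [Module R A]
    [AddCommGroup E] [Module R E] (i : A →ₗ[R] E)
    (h : ∀ f : A →ₗ[R] ResidueField R, ∃ g : E →ₗ[R] ResidueField R, g ∘ₗ i = f) :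
    Function.Injective (i.lTensor (ResidueField R)) := by
  rw [← LinearMap.ker_eq_bot, LinearMap.ker_eq_bot']
  intro t ht
  refine (Module.forall_dual_apply_eq_zero_iff (ResidueField R) t).1 fun φ => ?_
  obtain ⟨g, hg⟩ := h (φ.restrictScalars R ∘ₗ TensorProduct.mk R (ResidueField R) A 1)
  have key (t : ResidueField R ⊗[R] A) :
      g.liftBaseChange (ResidueField R) (i.lTensor (ResidueField R) t) = φ t := by
    induction t with
    | zero => simp
    | add x y hx hy => rw [map_add, map_add, map_add, hx, hy]
    | tmul a x =>
      rw [LinearMap.lTensor_tmul, LinearMap.liftBaseChange_tmul]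
      have h₁ : g (i x) = φ (1 ⊗ₜ x) := congr($hg x)
      rw [h₁, ← map_smul, TensorProduct.smul_tmul', smul_eq_mul, mul_one]
  rw [← key, ht, map_zero]

/-- Nakayama's lemma gives `k ⊗ M ≠ 0`, and a nonzero functional on it restricts to a nonzero map on
`M`. -/
theorem exists_surjective_residueField (M : Type u) [AddCommGroup M] [Module R M]
    [Module.Finite R M] [Nontrivial M] : ∃ f : M →ₗ[R] ResidueField R, Function.Surjective f := by
  have : Nontrivial (ResidueField R ⊗[R] M) := by
    rw [← not_subsingleton_iff_nontrivial, IsLocalRing.subsingleton_tensorProduct,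
      not_subsingleton_iff_nontrivial]
    infer_instance
  obtain ⟨t, ht⟩ := exists_ne (0 : ResidueField R ⊗[R] M)
  have : ∃ φ : Module.Dual (ResidueField R) (ResidueField R ⊗[R] M), φ ≠ 0 := by
    by_contra! h
    exact ht ((Module.forall_dual_apply_eq_zero_iff (ResidueField R) t).1 fun φ => by
      rw [h φ, LinearMap.zero_apply])
  obtain ⟨φ, hφ⟩ := this
  obtain ⟨m, hm⟩ : ∃ m : M, φ (1 ⊗ₜ m) ≠ 0 := by
    by_contra! h
    refine hφ (LinearMap.ext fun t => ?_)
    induction t with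
    | zero => simp
    | add x y hx hy => rw [map_add, map_add, hx, hy]
    | tmul a x =>
      have : a ⊗ₜ[R] x = a • (1 : ResidueField R) ⊗ₜ[R] x := by
        rw [TensorProduct.smul_tmul', smul_eq_mul, mul_one]
      rw [this, map_smul, h, smul_zero, LinearMap.zero_apply]
  refine ⟨φ.restrictScalars R ∘ₗ TensorProduct.mk R (ResidueField R) M 1, fun w => ?_⟩
  obtain ⟨r, hr⟩ := IsLocalRing.residue_surjective (w / φ (1 ⊗ₜ m))
  refine ⟨r • m, ?_⟩
  rw [map_smul]
  change r • φ (1 ⊗ₜ m) = w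
  rw [Algebra.smul_def, ResidueField.algebraMap_eq, hr, div_mul_cancel₀ _ hm]

theorem IsSemidualizing.nontrivial (hC : IsSemidualizing C) : Nontrivial C := by
  rw [← not_subsingleton_iff_nontrivial]
  intro h
  exact one_ne_zero (hC.eq_zero_of_forall_smul (r := 1) fun c => Subsingleton.elim _ _)

theorem IsSemidualizing.not_free (hC : IsSemidualizing C) (hCR : IsEmpty (C ≃ₗ[R] R)) :
    ¬ Module.Free R C := by
  intro h
  have := hC.nontrivial
  let b := Module.Free.chooseBasis R C
  obtain ⟨i⟩ : Nonempty (Module.Free.ChooseBasisIndex R C) := b.index_nonempty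
  have h₁ := hC.apply_mem_maximalIdeal hCR (b.coord i) (b i)
  rw [b.coord_apply, b.repr_self, Finsupp.single_eq_same] at h₁
  exact (Ideal.ne_top_iff_one _).1 (maximalIdeal.isMaximal R).ne_top h₁

theorem IsSemidualizing.nontrivial_ext_residueField (hC : IsSemidualizing C)
    (hCR : IsEmpty (C ≃ₗ[R] R)) (n : ℕ) :
    Nontrivial (((Ext R (ModuleCat.{u} R) (n + 1)).obj (Opposite.op C)).obj
      (ModuleCat.of R (ResidueField R))) := by
  rw [← not_subsingleton_iff_nontrivial]
  intro h
  obtain ⟨F⟩ := hC.resolution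
  rw [subsingleton_Ext_iff F (fun n => projective_of_finiteFree (F.mem n))] at h
  have := hC.finite
  have := hC.nontrivial
  obtain ⟨ε, hε⟩ := exists_surjective_residueField (R := R) C
  -- If maps to `k` extend from `Ω_{j+1}` to `F_j`, then `k ⊗ Ω_{j+1} → k ⊗ F_j` is injective, so
  -- `Ω_j` is free. No minimal resolution is required.
  have hfree (j : ℕ) (hj : ∀ f : cokerD F.complex (j + 1) →ₗ[R] ResidueField R,
      ∃ g : F.complex.X j →ₗ[R] ResidueField R, g ∘ₗ cokerDMap F.complex j = f) :
      Module.Free R (cokerD F.complex j) := by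
    have := (F.mem j).1
    have := (F.mem j).2
    have := (F.mem (j + 1)).2
    exact Module.free_of_lTensor_residueField_injective (cokerDMap F.complex j) _
      (Submodule.mkQ_surjective _) (cokerDMap_exact F.complex j)
      (lTensor_residueField_injective _ hj)
  have key (j : ℕ) (hj : Module.Free R (cokerD F.complex j)) :
      Module.Free R (cokerD F.complex 0) := by
    induction j with
    | zero => exact hj
    | succ j ih =>
      refine ih (hfree j fun f => ?_)
      -- The free module `Ω_{j+1}` allows `f` to be lifted through `C → k`, and maps to `C` extend
      -- because `Ext(C, C) = 0`.
      obtain ⟨f', rfl⟩ := Module.projective_lifting_property ε f hε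
      obtain ⟨g, rfl⟩ := hC.exists_extension_self F j f'
      exact ⟨ε ∘ₗ g, LinearMap.comp_assoc _ _ _⟩
  have := key n (hfree n (exists_extension_cokerDMap n (Y := ModuleCat.of R (ResidueField R)) h))
  exact hC.not_free hCR (Module.Free.of_equiv F.cokerDZeroEquiv)

end

section RelativeDimension

theorem relPd_lt_top_of_dimLE {𝒳 : ObjectProperty (ModuleCat.{u} R)}
    (h0 : 𝒳 (ModuleCat.of R PUnit)) (n : ℕ) {M : ModuleCat.{u} R} (hM : DimLE 𝒳 n M) :
    relPd 𝒳 M < ⊤ := by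
  -- Only the length matters here, so the test class is empty.
  obtain ⟨X, hX, -⟩ := DimLE.exists_resolution (𝒵 := fun _ => False) h0
    (fun _ _ _ _ h => h.elim) n hM
  refine (iInf_le _ X).trans_lt (lt_of_le_of_lt (b := ((n : ℕ∞) : WithBot ℕ∞)) ?_ ?_)
  · refine iSup₂_le fun m hm => ?_
    by_contra h
    have hnm : n < m := by simpa using h
    exact not_subsingleton_iff_nontrivial.2 hm (hX m hnm)
  · exact WithBot.coe_lt_coe.2 (ENat.natCast_lt_top n)

theorem exists_resolution_of_relPd_lt {𝒳 : ObjectProperty (ModuleCat.{u} R)} {M : ModuleCat.{u} R}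
    {n : ℕ} (h : relPd 𝒳 M < ((n : ℕ∞) : WithBot ℕ∞)) :
    ∃ X : Resolution 𝒳 M, ∀ m, n ≤ m → Subsingleton (X.complex.X m) := by
  obtain ⟨X, hX⟩ := iInf_lt_iff.1 h
  refine ⟨X, fun m hm => ?_⟩
  by_contra hn
  rw [not_subsingleton_iff_nontrivial] at hn
  have h₁ : ((m : ℕ∞) : WithBot ℕ∞) ≤ X.length :=
    le_iSup₂_of_le (f := fun (n : ℕ) (_ : Nontrivial (X.complex.X n)) =>
      ((n : ℕ∞) : WithBot ℕ∞)) m hn le_rfl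
  have h₂ : m < n := by simpa using h₁.trans_lt hX
  omega

theorem exists_nat_lt_of_lt_top {a : WithBot ℕ∞} (h : a < ⊤) :
    ∃ n : ℕ, a < ((n : ℕ∞) : WithBot ℕ∞) := by
  induction a with
  | bot => exact ⟨0, WithBot.bot_lt_coe _⟩
  | coe a =>
    have ha : a ≠ ⊤ := by
      rintro rfl
      exact lt_irrefl _ h
    lift a to ℕ using ha
    exact ⟨a + 1, by exact_mod_cast Nat.lt_succ_self a⟩

theorem PC.exists_proper_resolution (hC : IsSemidualizing C) (n : ℕ) {M : ModuleCat.{u} R}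
    (hM : DimLE (PC C) n M) : ∃ X : Resolution (PC C) M, X.IsProper ∧
      ∀ m, n < m → Subsingleton (X.complex.X m) := by
  obtain ⟨X, hX, hX'⟩ := DimLE.exists_resolution (PC.of_subsingleton C _)
    (fun n M hM A hA => hC.extVanishes_of_dimLE (hC.PC_le_GPC A hA) n hM 0) n hM
  exact ⟨X, hX', hX⟩

theorem dimLE_GPC_of_relPd_lt {M : ModuleCat.{u} R} {n : ℕ}
    (h : relPd (GPC C) M < ((n + 1 : ℕ) : ℕ∞)) : DimLE (GPC C) n M := by
  obtain ⟨X, hX⟩ := exists_resolution_of_relPd_lt h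
  have := hX (n + 1) le_rfl
  exact X.dimLE (fun e h => h.of_linearEquiv e) n
    ((X.mem n).of_linearEquiv (cokerDEquivOfSubsingleton X.complex n))

/-- Taking `N = Ω_{n+1}` and the tautological cocycle, the identity of `Ω_{n+1}` extends to `X_n`.
Hence `0 → Ω_{n+1} → X_n → Ω_n → 0` splits and `Ω_n` is a retract of `X_n`. -/
theorem IsSemidualizing.dimLE_PC_of_ext_subsingleton (hC : IsSemidualizing C)
    {M : ModuleCat.{u} R} (X : Resolution (PC C) M) (n : ℕ)
    (h : ∀ N, Subsingleton (X.ext N (n + 1))) : DimLE (PC C) n M := by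
  obtain ⟨g, hg⟩ := exists_extension_cokerDMap n (Y := cokerD X.complex (n + 1))
    ((linearYonedaObj_homology_subsingleton_iff _ _ _).1 (h (cokerD X.complex (n + 1))))
    LinearMap.id
  obtain ⟨s, hs⟩ := exists_comp_eq_of_ker_le
    (Submodule.mkQ_surjective (LinearMap.range (X.complex.d (n + 1) n).hom))
    (LinearMap.id - cokerDMap X.complex n ∘ₗ g) fun x hx => by
      obtain ⟨y, rfl⟩ := (cokerDMap_exact X.complex n x).1 hx
      have : g (cokerDMap X.complex n y) = y := congr($hg y)
      simp [this]
  refine X.dimLE (fun e h => h.of_linearEquiv e.symm) n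
    (PC.of_retract hC (X.mem n) s (Submodule.mkQ _) (LinearMap.ext fun z => ?_))
  obtain ⟨x, rfl⟩ := Submodule.mkQ_surjective _ z
  rw [LinearMap.comp_apply, hs, LinearMap.sub_apply, map_sub, LinearMap.comp_apply,
    (cokerDMap_exact X.complex n).apply_apply_eq_zero, sub_zero]
  rfl

theorem IsSemidualizing.relative_ext_of_relPd (hC : IsSemidualizing C) (M : ModuleCat.{u} R)
    (hG : relPd (GPC C) M < ⊤) (hP : relPd (PC C) M = ⊤) :
    HasProperResolution (GPC C) M ∧
      ∀ n : ℕ, relPd (GPC C) M < ((n : ℕ∞) : WithBot ℕ∞) →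
        (∀ X : Resolution (GPC C) M, X.IsProper → ∀ N : ModuleCat.{u} R, Subsingleton (X.ext N n)) ∧
        (∀ X : Resolution (PC C) M, X.IsProper →
          ∃ N : ModuleCat.{u} R, Nontrivial (X.ext N n)) := by
  have h0 := PC.of_subsingleton C (ModuleCat.of R PUnit)
  have hn (n : ℕ) (hM : DimLE (PC C) n M) : False := by
    have := relPd_lt_top_of_dimLE h0 n hM
    rw [hP] at this
    exact lt_irrefl _ this
  -- Dimension below `0` means `M = 0`, which is `C`-projective and so excluded by `hP`.
  have hpos (n : ℕ) (h : relPd (GPC C) M < ((n : ℕ∞) : WithBot ℕ∞)) : ∃ m, n = m + 1 := by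
    refine Nat.exists_eq_succ_of_ne_zero ?_
    rintro rfl
    obtain ⟨X, hX⟩ := exists_resolution_of_relPd_lt h
    have := hX 0 le_rfl
    have : Subsingleton M := X.surjective_π.subsingleton
    exact hn 0 (PC.of_subsingleton C M)
  have hres (n : ℕ) (h : relPd (GPC C) M < ((n : ℕ∞) : WithBot ℕ∞)) :
      ∃ X : Resolution (GPC C) M, X.IsProper ∧ Subsingleton (X.complex.X n) := by
    obtain ⟨m, rfl⟩ := hpos n h
    obtain ⟨X, hX, hX'⟩ := hC.exists_proper_resolution m (dimLE_GPC_of_relPd_lt h)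
    exact ⟨X, hX, hX' _ m.lt_succ_self⟩
  obtain ⟨n₀, hn₀⟩ := exists_nat_lt_of_lt_top hG
  obtain ⟨X₀, hX₀, -⟩ := hres n₀ hn₀
  refine ⟨⟨X₀, hX₀⟩, fun n h => ⟨fun X hX N => ?_, fun X _ => ?_⟩⟩
  · obtain ⟨Y, hY, hY'⟩ := hres n h
    obtain ⟨m, rfl⟩ := hpos n h
    exact X.subsingleton_ext_succ_of_subsingleton Y hX hY N m hY'
  · obtain ⟨m, rfl⟩ := hpos n h
    by_contra! hN
    exact hn m (hC.dimLE_PC_of_ext_subsingleton X m hN)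

end RelativeDimension

end

/-! ### The module `R/xR`. -/

noncomputable section
variable {R : Type u} [CommRing R] {C : ModuleCat.{u} R}

open IsLocalRing

theorem mkQ_span_singleton_eq_zero_iff {x r : R} :
    (Ideal.span {x}).mkQ r = 0 ↔ ∃ s, x * s = r := by
  rw [Submodule.mkQ_apply, Submodule.Quotient.mk_eq_zero, Ideal.mem_span_singleton]
  exact ⟨fun ⟨s, hs⟩ => ⟨s, hs.symm⟩, fun ⟨s, hs⟩ => ⟨s, hs.symm⟩⟩

theorem exact_mul_mkQ (x : R) :
    Function.Exact (LinearMap.lsmul R R x) (Ideal.span {x}).mkQ :=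
  fun _ => mkQ_span_singleton_eq_zero_iff

theorem injective_lsmul {x : R} (hx : x ∈ nonZeroDivisors R) :
    Function.Injective (LinearMap.lsmul R R x) := by
  rw [← LinearMap.ker_eq_bot, LinearMap.ker_eq_bot']
  exact fun r hr => (mem_nonZeroDivisors_iff.1 hx).1 r hr

theorem exists_smul_eq_of_mkQ_eq_zero {x : R} (hx : x ∈ nonZeroDivisors R) {A : Type*}
    [AddCommGroup A] [Module R A] (f : A →ₗ[R] R) (h : ∀ a, (Ideal.span {x}).mkQ (f a) = 0) :
    ∃ g : A →ₗ[R] R, x • g = f := by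
  let e := LinearEquiv.ofInjective _ (injective_lsmul hx)
  have hf (a : A) : f a ∈ LinearMap.range (LinearMap.lsmul R R x) := by
    obtain ⟨s, hs⟩ := mkQ_span_singleton_eq_zero_iff.1 (h a)
    exact ⟨s, hs⟩
  refine ⟨e.symm.toLinearMap ∘ₗ f.codRestrict _ hf, LinearMap.ext fun a => ?_⟩
  have h₁ := congrArg Subtype.val (e.apply_symm_apply (f.codRestrict _ hf a))
  exact h₁

theorem mulSequence_shortExact {x : R} (hx : x ∈ nonZeroDivisors R) :
    (mulSequence x).ShortExact :=
  mkShort_shortExact (exact_mul_mkQ x) (injective_lsmul hx) (Submodule.mkQ_surjective _)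

variable [IsLocalRing R]

theorem IsSemidualizing.not_forall_exists_lift (hC : IsSemidualizing C)
    (hCR : IsEmpty (C ≃ₗ[R] R)) {x : R} (hxm : x ∈ maximalIdeal R) (hx : x ∈ nonZeroDivisors R) :
    ¬ ∀ G : ModuleCat.{u} R, GPC C G → ∀ f : G →ₗ[R] R ⧸ Ideal.span {x},
      ∃ g : G →ₗ[R] R, (Ideal.span {x}).mkQ ∘ₗ g = f := by
  intro h
  obtain ⟨-, U, G', k, q, hU, hG', hk, hkq, hq⟩ := hC.isCoresolving_GPC _ hC.gpc_ring
  obtain ⟨G, i, p, v, hG, -, hip, -, hpv, hiv⟩ := hC.exists_gpc_pushout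
    (M' := ModuleCat.of R R) (G₀ := ModuleCat.of R R) (M := ModuleCat.of R (R ⧸ Ideal.span {x}))
    (LinearMap.lsmul R R x) (Ideal.span {x}).mkQ (injective_lsmul hx) (exact_mul_mkQ x)
    (Submodule.mkQ_surjective _) k q hk hkq hq hC.gpc_ring hG'
  obtain ⟨g, hg⟩ := h G hG p
  have hg' (y) : (Ideal.span {x}).mkQ (g y) = p y := congr($hg y)
  -- The value `g (v 1)` is congruent to `1` modulo `x ∈ 𝔪`.
  have hunit : IsUnit (g (v 1)) := by
    have h₁ : (Ideal.span {x}).mkQ (g (v 1) - 1) = 0 := by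
      rw [map_sub, hg', hpv, sub_self]
    obtain ⟨s, hs⟩ := mkQ_span_singleton_eq_zero_iff.1 h₁
    by_contra hu
    have h₂ : g (v 1) ∈ maximalIdeal R := hu
    have h₃ : (1 : R) ∈ maximalIdeal R := by
      have : (1 : R) = g (v 1) - x * s := by rw [hs]; ring
      rw [this]
      exact sub_mem h₂ (Ideal.mul_mem_right _ _ hxm)
    exact (Ideal.ne_top_iff_one _).1 (maximalIdeal.isMaximal R).ne_top h₃
  -- On `U` the lift `g` takes values in `xR`, so it is `x` times some `l : U → R`. As `i (k 1) = x
  -- • v 1`, cancelling `x` shows that `l (k 1)` is the unit `g (v 1)`.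
  obtain ⟨l, hl⟩ := exists_smul_eq_of_mkQ_eq_zero hx (g ∘ₗ i) fun y => by
    rw [LinearMap.comp_apply, hg', hip.apply_apply_eq_zero]
  have hl1 : l (k 1) = g (v 1) := by
    refine injective_lsmul hx ?_
    have h₁ : x • l (k 1) = g (i (k 1)) := congr($hl (k 1))
    have h₂ : (LinearMap.lsmul R R x) (1 : R) = x • (1 : R) := rfl
    have h₃ : i (k 1) = v (x • (1 : R)) := hiv 1
    have h₄ : v (x • (1 : R)) = x • v 1 := map_smul v x 1
    rw [h₃, h₄, map_smul] at h₁
    exact h₁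
  exact (hU.apply_mem_maximalIdeal hC hCR l (k 1)) (hl1 ▸ hunit)

theorem IsSemidualizing.not_isHomExact_mulSequence (hC : IsSemidualizing C)
    (hCR : IsEmpty (C ≃ₗ[R] R)) {x : R} (hxm : x ∈ maximalIdeal R) (hx : x ∈ nonZeroDivisors R) :
    ¬ IsHomExact (GPC C) (mulSequence x) := by
  intro h
  refine hC.not_forall_exists_lift hCR hxm hx fun G hG f => ?_
  obtain ⟨g, hg⟩ := (h G hG).moduleCat_surjective_g (ModuleCat.ofHom f)
  exact ⟨(show G ⟶ ModuleCat.of R R from g).hom, congr(ModuleCat.Hom.hom $hg)⟩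

omit [IsLocalRing R] in
theorem IsSemidualizing.dimLE_one_quotient (hC : IsSemidualizing C) {x : R}
    (hx : x ∈ nonZeroDivisors R) :
    DimLE (GPC C) 1 (ModuleCat.of R (R ⧸ Ideal.span {x})) :=
  ⟨ModuleCat.of R R, ModuleCat.of R R, LinearMap.lsmul R R x, (Ideal.span {x}).mkQ, hC.gpc_ring,
    hC.gpc_ring, injective_lsmul hx, exact_mul_mkQ x, Submodule.mkQ_surjective _⟩

/-- The class hit is that of `0 → R → R → R/xR → 0`. A relative preimage yields `u : X_0 → R`
lifting `X_0 → R/xR`, and properness then lifts every map from a `G_C`-projective to `R/xR`. -/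
theorem IsSemidualizing.not_surjective_comparison (hC : IsSemidualizing C)
    (hCR : IsEmpty (C ≃ₗ[R] R)) {x : R} (hxm : x ∈ maximalIdeal R) (hx : x ∈ nonZeroDivisors R)
    (X : Resolution (GPC C) (ModuleCat.of R (R ⧸ Ideal.span {x}))) (hX : X.IsProper)
    {P : ProjectiveResolution (ModuleCat.of R (R ⧸ Ideal.span {x}))} (φ : X.Lift P) :
    ¬ Function.Surjective (X.comparison φ (ModuleCat.of R R) 1) := by
  intro hsurj
  replace hsurj : Function.Surjective
      (HomologicalComplex.homologyMap (homMap φ.hom (ModuleCat.of R R)) 1) := by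
    intro y
    obtain ⟨z, hz⟩ := hsurj ((P.isoExt 1 (ModuleCat.of R R)).inv y)
    exact ⟨z, (P.isoExt 1 (ModuleCat.of R R)).symm.toLinearEquiv.injective hz⟩
  have hq : Function.Surjective (Ideal.span {x}).mkQ := Submodule.mkQ_surjective _
  let q : ModuleCat.of R R ⟶ ModuleCat.of R (R ⧸ Ideal.span {x}) :=
    ModuleCat.ofHom (Ideal.span {x}).mkQ
  have hqepi : Epi q := (ModuleCat.epi_iff_surjective _).2 hq
  let π₀ : P.complex.X 0 ⟶ ModuleCat.of R (R ⧸ Ideal.span {x}) := P.π.f 0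
  let e₀ : P.complex.X 0 ⟶ ModuleCat.of R R := Projective.factorThru π₀ q
  have he₀ : e₀ ≫ q = π₀ := Projective.factorThru_comp π₀ q
  have hπ₀ : P.complex.d 1 0 ≫ π₀ = 0 := P.complex_d_comp_π_f_zero
  -- The cocycle `e₁` of the extension is `e₀ ∘ d` divided by `x`.
  obtain ⟨e₁, he₁⟩ := exists_smul_eq_of_mkQ_eq_zero hx (P.complex.d 1 0 ≫ e₀).hom fun y => by
    have : (P.complex.d 1 0 ≫ e₀) ≫ q = 0 := by rw [Category.assoc, he₀, hπ₀]
    exact congr(($this).hom y)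
  have hxe (y) : x • e₁ y = e₀ (P.complex.d 1 0 y) := congr($he₁ y)
  have hcocycle : P.complex.d 2 1 ≫ ModuleCat.ofHom e₁ = 0 := by
    ext y
    refine injective_lsmul hx ?_
    have h₁ : P.complex.d 1 0 (P.complex.d 2 1 y) = 0 :=
      congr(($(P.complex.d_comp_d 2 1 0)).hom y)
    have h₂ := hxe (P.complex.d 2 1 y)
    rw [h₁, map_zero] at h₂
    exact h₂.trans (map_zero _).symm
  obtain ⟨ξ, hξ⟩ := exists_isClass_of_d_eq_zero
    (K := P.complex.linearYonedaObj R (ModuleCat.of R R)) (n := 1) (ModuleCat.ofHom e₁) hcocycle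
  obtain ⟨η, hη⟩ := hsurj ξ
  obtain ⟨f, hf, hfη⟩ := exists_isClass η
  obtain ⟨g, hg⟩ := ((hfη.map (homMap φ.hom (ModuleCat.of R R))).eq_iff hξ).1 hη
  change X.complex.X 1 ⟶ ModuleCat.of R R at f
  change P.complex.X 0 ⟶ ModuleCat.of R R at g
  replace hf : X.complex.d 2 1 ≫ f = 0 := hf
  replace hg : P.complex.d 1 0 ≫ g = φ.hom.f 1 ≫ f - ModuleCat.ofHom e₁ := hg
  -- The pullback of `f` is `e₁ + g ∘ d`. Multiplied by `x` it becomes `(e₀ + x g) ∘ d`, so the two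
  -- maps glue, and modulo `x` the result is `π`.
  obtain ⟨u, hu₁, hu₀⟩ := X.exists_glue φ (x • f) (e₀ + x • g)
    (by rw [Linear.comp_smul, hf, smul_zero]) (by
      have : P.complex.d 1 0 ≫ e₀ = x • ModuleCat.ofHom e₁ := by
        ext y
        exact (hxe y).symm
      rw [Preadditive.comp_add, Linear.comp_smul, hg, this, Linear.comp_smul (R := R), smul_sub]
      abel)
  have hu : u ≫ q = X.π := by
    ext y
    obtain ⟨b, p, rfl⟩ := X.surjective_coprod_lift φ y
    have h₁ : u (X.complex.d 1 0 b) = x * f b := congr(($hu₁).hom b)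
    have h₂ : u (φ.hom.f 0 p) = e₀ p + x * g p := congr(($hu₀).hom p)
    have h₃ : X.π (X.complex.d 1 0 b) = 0 := congr(($(X.d_comp_π)).hom b)
    have h₄ : X.π (φ.hom.f 0 p) = π₀ p := congr(($(φ.comm)).hom p)
    have h₅ : (Ideal.span {x}).mkQ (e₀ p) = π₀ p := congr(($he₀).hom p)
    have h₆ (s : R) : (Ideal.span {x}).mkQ (x * s) = 0 :=
      mkQ_span_singleton_eq_zero_iff.2 ⟨s, rfl⟩
    change (Ideal.span {x}).mkQ (u (X.complex.d 1 0 b + φ.hom.f 0 p)) =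
      X.π (X.complex.d 1 0 b + φ.hom.f 0 p)
    rw [map_add, map_add, map_add, h₁, h₂, h₃, h₄, map_add, h₅, h₆, h₆, add_zero]
  refine hC.not_forall_exists_lift hCR hxm hx fun G hG f' => ?_
  obtain ⟨w, hw⟩ := ((Resolution.homFrom_augment_acyclic_iff _ _ _ _).1 (hX G hG)).1
    (ModuleCat.ofHom f')
  refine ⟨(w ≫ u).hom, ?_⟩
  have : (w ≫ u) ≫ q = ModuleCat.ofHom f' := by rw [Category.assoc, hu, hw]
  exact congr(($this).hom)

/-- A prime containing the non-zero-divisor `x` is not minimal, so in dimension one it is `𝔪`; thus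
`𝔪` lies in the radical of `(x)`. -/
theorem exists_pow_mem_span_singleton {x : R} (hx : x ∈ nonZeroDivisors R)
    (hdim : ringKrullDim R = 1) {s : R} (hs : s ∈ maximalIdeal R) :
    ∃ n : ℕ, s ^ n ∈ Ideal.span {x} := by
  suffices h : s ∈ (Ideal.span {x}).radical from h
  rw [Ideal.radical_eq_sInf, Submodule.mem_sInf]
  rintro p ⟨hxp, hp⟩
  have hxp : x ∈ p := hxp (Ideal.mem_span_singleton_self x)
  have hd : Ring.KrullDimLE 1 R := Ring.krullDimLE_iff.2 hdim.le
  rcases Ring.krullDimLE_one_iff.1 hd p hp with h | h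
  · exact absurd hx (Set.disjoint_left.1
      (Ideal.disjoint_nonZeroDivisors_of_mem_minimalPrimes h) hxp)
  · rwa [IsLocalRing.eq_maximalIdeal h]

/-- `θ` is multiplication by some `s`. If `s` is not a unit, a power of `s` lies in `(x)` and kills
`E`, so the injective map `θ` is nilpotent and `E = 0`. -/
theorem surjective_of_injective_of_cyclic {x : R} (hx : x ∈ nonZeroDivisors R)
    (hdim : ringKrullDim R = 1) {E : Type*} [AddCommGroup E] [Module R E] {e : E}
    (he : ∀ y, ∃ r : R, y = r • e) (hxe : x • e = 0) (θ : E →ₗ[R] E)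
    (hθ : Function.Injective θ) : Function.Surjective θ := by
  obtain ⟨s, hs⟩ := he (θ e)
  by_cases hu : IsUnit s
  · obtain ⟨t, ht⟩ := hu.exists_left_inv
    intro y
    obtain ⟨r, rfl⟩ := he y
    exact ⟨r • t • e, by rw [map_smul, map_smul, hs, smul_smul t, ht, one_smul]⟩
  · obtain ⟨n, hn⟩ := exists_pow_mem_span_singleton hx hdim (s := s) hu
    obtain ⟨t, ht⟩ := Ideal.mem_span_singleton'.1 hn
    have hpow (m : ℕ) : θ^[m] e = s ^ m • e := by
      induction m with
      | zero => simp
      | succ m ih => rw [Function.iterate_succ_apply', ih, map_smul, hs, smul_smul, pow_succ]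
    have he0 : e = 0 := by
      refine hθ.iterate n ?_
      rw [hpow, ← ht, mul_smul, hxe, smul_zero, Function.iterate_fixed (map_zero θ)]
    intro y
    obtain ⟨r, rfl⟩ := he y
    exact ⟨0, by rw [he0, smul_zero, map_zero]⟩

omit [IsLocalRing R] in
theorem finiteFree_ring : finiteFree R (ModuleCat.of R R) := ⟨inferInstance, inferInstance⟩

omit [IsLocalRing R] in
theorem finiteFree_punit : finiteFree R (ModuleCat.of R PUnit) :=
  ⟨Module.Free.of_subsingleton _ _, inferInstance⟩

/-- The free resolution `0 → R → R → R/xR → 0`. -/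
def mulResolution (x : R) (hx : x ∈ nonZeroDivisors R) :
    Resolution (finiteFree R) (ModuleCat.of R (R ⧸ Ideal.span {x})) :=
  ((Resolution.zero (ModuleCat.of R PUnit) finiteFree_punit).splice finiteFree_ring 0 LinearMap.id
    (Function.injective_of_subsingleton _) (exact_zero_id (ModuleCat.of R R))
    Function.surjective_id).splice finiteFree_ring (K := ModuleCat.of R R)
    (LinearMap.lsmul R R x) (Ideal.span {x}).mkQ (injective_lsmul hx) (exact_mul_mkQ x)
    (Submodule.mkQ_surjective _)

-- In the resolution `0 → R → R`, every `1`-cochain is a multiple of the identity, and `x` times the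
-- identity is a coboundary.
omit [IsLocalRing R] in
theorem exists_cyclic_ext_one {x : R} (hx : x ∈ nonZeroDivisors R) :
    ∃ e : ((Ext R (ModuleCat.{u} R) 1).obj
      (Opposite.op (ModuleCat.of R (R ⧸ Ideal.span {x})))).obj (ModuleCat.of R R),
      (∀ y, ∃ r : R, y = r • e) ∧ x • e = 0 := by
  let X := mulResolution x hx
  let Q := X.toProjectiveResolution fun n => projective_of_finiteFree (X.mem n)
  let α := (Q.isoExt (R := R) 1 (ModuleCat.of R R)).toLinearEquiv
  let K := Q.complex.linearYonedaObj R (ModuleCat.of R R)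
  let one : K.X 1 := 𝟙 (ModuleCat.of R R)
  have hcoc (f : K.X 1) : K.d 1 2 f = 0 :=
    (ModuleCat.isZero_of_subsingleton (ModuleCat.of R PUnit)).eq_of_src _ _
  obtain ⟨e, he⟩ := exists_isClass_of_d_eq_zero (K := K) one (hcoc _)
  refine ⟨α.symm e, fun y => ?_, ?_⟩
  · obtain ⟨f, -, hf⟩ := exists_isClass (K := K) (α y)
    let f' : ModuleCat.of R R ⟶ ModuleCat.of R R := f
    refine ⟨f' (1 : R), ?_⟩
    rw [← map_smul, LinearEquiv.eq_symm_apply]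
    have hf' : f = f' (1 : R) • one := by
      change f' = f' (1 : R) • 𝟙 (ModuleCat.of R R)
      ext
      simp
    refine (hf.eq_iff (he.smul (f' (1 : R)))).2 ⟨0, ?_⟩
    rw [map_zero, ← hf', sub_self]
  · rw [← map_smul, LinearEquiv.map_eq_zero_iff, (he.smul x).eq_zero_iff]
    refine ⟨one, ?_⟩
    change ModuleCat.ofHom (LinearMap.id (R := R) (M := R)) ≫
      ModuleCat.ofHom (LinearMap.lsmul R R x) ≫ 𝟙 (ModuleCat.of R R) =
      x • 𝟙 (ModuleCat.of R R)
    ext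
    simp

theorem IsSemidualizing.isEmpty_ext_equiv (hC : IsSemidualizing C)
    (hCR : IsEmpty (C ≃ₗ[R] R)) {x : R} (hxm : x ∈ maximalIdeal R) (hx : x ∈ nonZeroDivisors R)
    (X : Resolution (GPC C) (ModuleCat.of R (R ⧸ Ideal.span {x}))) (hX : X.IsProper)
    (hdim : ringKrullDim R = 1) : IsEmpty (X.ext (ModuleCat.of R R) 1 ≃ₗ[R]
      ((Ext R (ModuleCat.{u} R) 1).obj
        (Opposite.op (ModuleCat.of R (R ⧸ Ideal.span {x})))).obj (ModuleCat.of R R)) := by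
  refine ⟨fun ε => ?_⟩
  obtain ⟨e, he, hxe⟩ := exists_cyclic_ext_one hx
  obtain ⟨φ⟩ := X.nonempty_lift (ProjectiveResolution.of _)
  have hinj := X.injective_comparison φ (ModuleCat.of R R)
  have hsurj := surjective_of_injective_of_cyclic hx hdim he hxe
    ((X.comparison φ (ModuleCat.of R R) 1).hom ∘ₗ ε.symm.toLinearMap)
    (hinj.comp ε.symm.injective)
  exact hC.not_surjective_comparison hCR hxm hx X hX φ (Function.Surjective.of_comp hsurj)

end

end RelCoh
-- Assembly of the three statements.
theorem proposition5p1 {R : Type u} [CommRing R] [IsLocalRing R] (C : ModuleCat.{u} R)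
    (hC : RelCoh.IsSemidualizing C) (hCR : IsEmpty (C ≃ₗ[R] R)) :
    -- (a)
    (RelCoh.HasProperResolution (RelCoh.PC C) C ∧ RelCoh.HasProperResolution (RelCoh.GPC C) C ∧
      ∀ n : ℕ, 1 ≤ n →
        (∀ X : RelCoh.Resolution (RelCoh.PC C) C, X.IsProper →
          Subsingleton (X.ext (ModuleCat.of R (IsLocalRing.ResidueField R)) n)) ∧
        (∀ X : RelCoh.Resolution (RelCoh.GPC C) C, X.IsProper →
          Subsingleton (X.ext (ModuleCat.of R (IsLocalRing.ResidueField R)) n)) ∧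
        Nontrivial (((Ext R (ModuleCat.{u} R) n).obj (Opposite.op C)).obj
          (ModuleCat.of R (IsLocalRing.ResidueField R)))) ∧
    -- (b)
    (∀ x ∈ IsLocalRing.maximalIdeal R, x ∈ nonZeroDivisors R →
      (RelCoh.mulSequence x).ShortExact ∧
      ¬ RelCoh.IsHomExact (RelCoh.GPC C) (RelCoh.mulSequence x) ∧
      RelCoh.HasProperResolution (RelCoh.GPC C) (ModuleCat.of R (R ⧸ Ideal.span {x})) ∧
      ∀ X : RelCoh.Resolution (RelCoh.GPC C) (ModuleCat.of R (R ⧸ Ideal.span {x})), X.IsProper →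
        (∀ P : ProjectiveResolution (ModuleCat.of R (R ⧸ Ideal.span {x})),
          Nonempty (X.Lift P) ∧
          ∀ φ : X.Lift P,
            Function.Injective (X.comparison φ (ModuleCat.of R R) 1) ∧
            ¬ Function.Surjective (X.comparison φ (ModuleCat.of R R) 1)) ∧
        (ringKrullDim R = 1 →
          IsEmpty (X.ext (ModuleCat.of R R) 1 ≃ₗ[R]
            ((Ext R (ModuleCat.{u} R) 1).obj
              (Opposite.op (ModuleCat.of R (R ⧸ Ideal.span {x})))).obj (ModuleCat.of R R)))) ∧
    -- (c)
    (∀ M : ModuleCat.{u} R, RelCoh.HasProperResolution (RelCoh.PC C) M →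
      RelCoh.relPd (RelCoh.GPC C) M < ⊤ → RelCoh.relPd (RelCoh.PC C) M = ⊤ →
      RelCoh.HasProperResolution (RelCoh.GPC C) M ∧
      ∀ n : ℕ, RelCoh.relPd (RelCoh.GPC C) M < ((n : ℕ∞) : WithBot ℕ∞) →
        (∀ X : RelCoh.Resolution (RelCoh.GPC C) M, X.IsProper →
          ∀ N : ModuleCat.{u} R, Subsingleton (X.ext N n)) ∧
        (∀ X : RelCoh.Resolution (RelCoh.PC C) M, X.IsProper →
          ∃ N : ModuleCat.{u} R, Nontrivial (X.ext N n))) := by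
  refine ⟨⟨?_, ?_, fun n hn => ?_⟩, fun x hxm hx => ⟨RelCoh.mulSequence_shortExact hx,
    hC.not_isHomExact_mulSequence hCR hxm hx, ?_, fun X hX => ⟨fun P => ⟨X.nonempty_lift P,
      fun φ => ⟨X.injective_comparison φ _, hC.not_surjective_comparison hCR hxm hx X hX φ⟩⟩,
      hC.isEmpty_ext_equiv hCR hxm hx X hX⟩⟩, fun M _ => hC.relative_ext_of_relPd M⟩
  · obtain ⟨X, hX, -⟩ := RelCoh.PC.exists_proper_resolution hC 0 (RelCoh.PC.self C)
    exact ⟨X, hX⟩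
  · obtain ⟨X, hX, -⟩ := hC.exists_proper_resolution 0 (hC.PC_le_GPC C (RelCoh.PC.self C))
    exact ⟨X, hX⟩
  · obtain ⟨n, rfl⟩ := Nat.exists_eq_add_of_le' hn
    -- `Y` and `Z` have length `0`, so their terms vanish in every degree `n + 1`.
    obtain ⟨Y, hY, hY'⟩ := RelCoh.PC.exists_proper_resolution hC 0 (RelCoh.PC.self C)
    obtain ⟨Z, hZ, hZ'⟩ := hC.exists_proper_resolution 0 (hC.PC_le_GPC C (RelCoh.PC.self C))
    exact ⟨fun X hX => X.subsingleton_ext_succ_of_subsingleton Y hX hY _ n (hY' _ n.succ_pos),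
      fun X hX => X.subsingleton_ext_succ_of_subsingleton Z hX hZ _ n (hZ' _ n.succ_pos),
      hC.nontrivial_ext_residueField hCR n⟩
  · obtain ⟨X, hX, -⟩ := hC.exists_proper_resolution 1 (hC.dimLE_one_quotient hx)
    exact ⟨X, hX⟩
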